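/- Let $k$ be a field. A connected graded $k$-algebra is a $\mathbb Z$-graded, locally finite $k$-algebra $A$ with $A_i=0$ for $i<0$ and $A_0=k$; $\varepsilon_A:A\to k$ is its augmentation. A minimal free resolution of the trivial module ${}_Ak$ is a complex of graded free modules $P^{-n}=A\otimes V_n$ ($n\ge 0$, $V_0=k$) with degree-preserving differentials satisfying $\operatorname{Im} d_P\subseteq A_{\ge 1}P$ and such that $\varepsilon_A:P^\bullet\to k$ is a quasi-isomorphism. The algebra is Ext-finite if all $V_n$ are finite dimensional, and has a pure resolution if each $V_n$ is concentrated in a single degree. Let $A$ and $B$ be connected Ext-finite graded algebras such that $B$ has a pure resolution, and let $y_1,\dots,y_m$ be a minimal generating set of $B$. Let $\tau:B\otimes A\to A\otimes B$ be a graded twisting map, that is, a graded linear map for which $(m_A\otimes m_B)(\mathrm{id}_A\otimes\tau\otimes\mathrm{id}_B)$ is an associative multiplication on $A\otimes B$ with unit $1\otimes 1$; let $C=A\otimes^\tau B$ be the resulting graded algebra, with augmentation $\varepsilon_C=\varepsilon_A\otimes\varepsilon_B$. Assume $\tau=(\sigma,0)$, i.e. $\tau(y_i\otimes a)=\sum_{t}\sigma_{it}(a)\otimes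 y_t$ for a graded algebra homomorphism $\sigma:A\to\mathbb M_m(A)$ (each $\sigma_{it}$ preserves degrees). Let $P^\bullet$ be a minimal free resolution of ${}_Ak$ and $Q^\bullet$, $Q^{-n}=B\otimes W_n$ with $W_n=k(-l_n)^{\oplus s_n}$, a minimal free resolution of ${}_Bk$ with $s_1=m$ and $d_Q^{-1}(1\otimes e_j)=y_j$. Let $F^\bullet=A\otimes^\tau Q^\bullet$, with terms $F^{-n}=C\otimes W_n$ and differentials $\mathrm{id}_A\otimes d_Q$. For a graded algebra homomorphism $\phi:A\to\mathbb M_s(A)$ and a graded vector space $W$ with basis $e_1,\dots,e_s$ concentrated in one degree, $(C\otimes W)^\phi$ denotes the $(C,A)$-bimodule $C\otimes W$ with right action $(\sum_i x_i\otimes e_i)*a=\sum_j\big(\sum_i x_i\,\phi_{ij}(a)\big)\otimes e_j$. Then there are graded algebra homomorphisms $\phi_n:A\to\mathbb M_{s_n}(A)$, $n\ge 0$, with $\phi_0=\mathrm{id}_A$ and $\phi_1=\sigma$, for which all differentials of $$F_\phi^\bullet=\big(\cdots\to (C\otimes W_2)^{\phi_2}\to (C\otimes W_1)^{\sigma}\to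 C\to 0\big)$$ are right $A$-linear. For every such family $(\phi_n)$, the morphism of complexes $\varepsilon_C:F_\phi^\bullet\otimes_A P^\bullet\to{}_Ck$ (which is $\varepsilon_C$ on the degree-zero term $C\otimes_A A=C$) is a quasi-isomorphism, and $F_\phi^\bullet\otimes_A P^\bullet$ is a minimal free resolution of the trivial module ${}_Ck$: its terms are graded free $C$-modules, its differentials and augmentation preserve degrees, and the image of the differential lies in $C_{\ge 1}\cdot(F_\phi^\bullet\otimes_A P^\bullet)$. -/

import Mathlib

open CategoryTheory TensorProduct

noncomputable section

universe u

namespace TwistedResolution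

/-! ## Connected graded algebras and their trivial module -/

section Connected

variable {k : Type u} [Field k] {A : Type u} [Ring A] [Algebra k A]

/-- A `ℤ`-graded `k`-algebra is connected if it is locally finite, vanishes in negative degrees
and has degree zero part `k`. -/
class IsConnectedGraded (𝒜 : ℤ → Submodule k A) [GradedAlgebra 𝒜] : Prop where
  nontrivial : Nontrivial A
  locally_finite : ∀ i, Module.Finite k (𝒜 i)
  neg : ∀ i < 0, 𝒜 i = ⊥
  zero : 𝒜 0 = Submodule.span k {1}

variable (𝒜 : ℤ → Submodule k A) [GradedAlgebra 𝒜] [IsConnectedGraded 𝒜]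

theorem bijective_unit :
    Function.Bijective ((Algebra.linearMap k A).codRestrict (𝒜 0)
      (fun c => by
        rw [IsConnectedGraded.zero (𝒜 := 𝒜), Submodule.mem_span_singleton]
        exact ⟨c, by simp [Algebra.algebraMap_eq_smul_one]⟩)) := by
  have := IsConnectedGraded.nontrivial (𝒜 := 𝒜)
  constructor
  · intro c c' h
    exact (algebraMap k A).injective (congrArg Subtype.val h)
  · rintro ⟨a, ha⟩
    have h := ha
    rw [IsConnectedGraded.zero (𝒜 := 𝒜), Submodule.mem_span_singleton] at h
    obtain ⟨c, rfl⟩ := h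
    exact ⟨c, Subtype.ext (by simp [Algebra.algebraMap_eq_smul_one])⟩

/-- The canonical isomorphism `k ≃ A₀`. -/
def unitEquiv : k ≃ₗ[k] 𝒜 0 := LinearEquiv.ofBijective _ (bijective_unit 𝒜)

/-- The augmentation as a linear map: projection onto `A₀ = k`. -/
def augmentationLinear : A →ₗ[k] k :=
  (unitEquiv 𝒜).symm.toLinearMap ∘ₗ DirectSum.component k ℤ (fun i => 𝒜 i) 0 ∘ₗ
    (DirectSum.decomposeLinearEquiv 𝒜).toLinearMap

theorem augmentationLinear_of_ne {i : ℤ} (hi : i ≠ 0) {a : A} (ha : a ∈ 𝒜 i) :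
    augmentationLinear 𝒜 a = 0 := by
  have h : (DirectSum.decompose 𝒜 a) 0 = 0 :=
    Subtype.ext (DirectSum.decompose_of_mem_ne 𝒜 ha hi)
  change (unitEquiv 𝒜).symm ((DirectSum.decompose 𝒜 a) 0) = 0
  rw [h, map_zero]

theorem augmentationLinear_algebraMap (c : k) :
    augmentationLinear 𝒜 (algebraMap k A c) = c := by
  have hm : algebraMap k A c ∈ 𝒜 0 := (unitEquiv 𝒜 c).2
  have h : (DirectSum.decompose 𝒜 (algebraMap k A c)) 0 = unitEquiv 𝒜 c :=
    Subtype.ext (DirectSum.decompose_of_mem_same 𝒜 hm)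
  change (unitEquiv 𝒜).symm ((DirectSum.decompose 𝒜 (algebraMap k A c)) 0) = c
  rw [h, LinearEquiv.symm_apply_apply]

theorem exists_algebraMap {a : A} (ha : a ∈ 𝒜 0) : ∃ c : k, a = algebraMap k A c := by
  rw [IsConnectedGraded.zero (𝒜 := 𝒜), Submodule.mem_span_singleton] at ha
  obtain ⟨c, rfl⟩ := ha
  exact ⟨c, by simp [Algebra.algebraMap_eq_smul_one]⟩

theorem eq_zero_of_neg {i : ℤ} (hi : i < 0) {a : A} (ha : a ∈ 𝒜 i) : a = 0 := by
  rw [IsConnectedGraded.neg (𝒜 := 𝒜) i hi] at ha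
  simpa using ha

theorem augmentationLinear_mul (a b : A) :
    augmentationLinear 𝒜 (a * b) = augmentationLinear 𝒜 a * augmentationLinear 𝒜 b := by
  induction a using DirectSum.Decomposition.inductionOn 𝒜 with
  | zero => simp
  | add a a' h h' => simp only [add_mul, map_add, h, h']
  | @homogeneous i a =>
    induction b using DirectSum.Decomposition.inductionOn 𝒜 with
    | zero => simp
    | add b b' h h' => simp only [mul_add, map_add, h, h']
    | @homogeneous j b =>
      rcases lt_trichotomy i 0 with hi | hi | hi
      · simp [eq_zero_of_neg 𝒜 hi a.2]
      · subst hi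
        obtain ⟨c, hc⟩ := exists_algebraMap 𝒜 a.2
        rw [hc, augmentationLinear_algebraMap, ← Algebra.smul_def, map_smul, smul_eq_mul]
      · rw [augmentationLinear_of_ne 𝒜 hi.ne' a.2, zero_mul]
        rcases lt_or_ge j 0 with hj | hj
        · simp [eq_zero_of_neg 𝒜 hj b.2]
        · exact augmentationLinear_of_ne 𝒜 (i := i + j) (by omega)
            (SetLike.GradedMul.mul_mem a.2 b.2)

/-- The augmentation `ε_A : A → k` of a connected graded algebra. -/
def augmentation : A →ₐ[k] k :=
  AlgHom.ofLinearMap (augmentationLinear 𝒜)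
    (by simpa using augmentationLinear_algebraMap 𝒜 1) (augmentationLinear_mul 𝒜)

end Connected

section Trivial

variable {k : Type u} [Field k] {C : Type u} [Ring C] [Algebra k C]

/-- The trivial left module `k` of an algebra `C` with augmentation `ε : C → k`. -/
@[nolint unusedArguments]
def TrivialModule (_ε : C →ₐ[k] k) : Type u := k

variable (ε : C →ₐ[k] k)

instance : AddCommGroup (TrivialModule ε) := inferInstanceAs (AddCommGroup k)
instance : Module k (TrivialModule ε) := inferInstanceAs (Module k k)
instance : Module C (TrivialModule ε) := Module.compHom k (ε : C →+* k)

theorem TrivialModule.smul_def (c : C) (x : k) :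
    (c • (show TrivialModule ε from x)) = (show TrivialModule ε from ε c * x) := rfl

instance : IsScalarTower k C (TrivialModule ε) where
  smul_assoc a c x := by
    change ε (a • c) * (show k from x) = a * (ε c * (show k from x))
    rw [map_smul, smul_eq_mul, mul_assoc]

end Trivial

/-! ## Gradings and minimal free resolutions -/

section Gradings

variable {k : Type u} [Field k] {C : Type u} [Ring C] [Algebra k C]

/-- The grading of the free module `C ⊗ V` in coordinates, where `V` has a basis whose `i`-th
element is homogeneous of degree `deg i`. -/
def freeGrading (𝒞 : ℤ → Submodule k C) {r : ℕ} (deg : Fin r → ℤ) (j : ℤ) :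
    Submodule k (Fin r → C) :=
  Submodule.pi Set.univ fun i => 𝒞 (j - deg i)

/-- The degree `n` part of `M ⊗ N`: the sum of all `M_p ⊗ N_q` with `p + q = n`. -/
def tensorGrading {M N : Type u} [AddCommGroup M] [Module k M] [AddCommGroup N] [Module k N]
    (ℳ : ℤ → Submodule k M) (𝒩 : ℤ → Submodule k N) (n : ℤ) : Submodule k (M ⊗[k] N) :=
  ⨆ p : ℤ, Submodule.map₂ (TensorProduct.mk k M N) (ℳ p) (𝒩 (n - p))

/-- A graded `C`-module is graded free if it is isomorphic, as a graded module, to a direct sum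
of shifts of `C`, that is, to `C ⊗ V` for a graded vector space `V`. -/
def IsGradedFree (𝒞 : ℤ → Submodule k C) {M : Type u} [AddCommGroup M] [Module C M]
    (ℳ : ℤ → AddSubgroup M) : Prop :=
  ∃ (I : Type u) (deg : I → ℤ) (e : M ≃ₗ[C] (I →₀ C)),
    ∀ (j : ℤ) (x : M), x ∈ ℳ j ↔ ∀ i, e x i ∈ 𝒞 (j - deg i)

/-- The submodule `C_{≥1} M` of a `C`-module `M`. -/
def positivePart (𝒞 : ℤ → Submodule k C) (M : Type u) [AddCommGroup M] [Module C M] :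
    Submodule C M :=
  Submodule.span C {z | ∃ j : ℤ, 1 ≤ j ∧ ∃ c ∈ 𝒞 j, ∃ x : M, z = c • x}

/-- A complex `T` of `C`-modules with gradings `𝒯` on its terms, together with a morphism `η` to
the trivial module placed in degree zero, is a minimal (graded) free resolution of the trivial
module: the terms are graded free, differential and augmentation preserve degrees, `η` is a
quasi-isomorphism, and the image of each differential lies in `C_{≥1} T`. -/
structure IsMinimalFreeResolution (𝒞 : ℤ → Submodule k C) (ε : C →ₐ[k] k)
    (T : ChainComplex (ModuleCat.{u} C) ℕ) (𝒯 : ∀ n, ℤ → AddSubgroup (T.X n))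
    (η : T ⟶ (ChainComplex.single₀ (ModuleCat.{u} C)).obj (ModuleCat.of C (TrivialModule ε))) :
    Prop where
  free : ∀ n, IsGradedFree 𝒞 (𝒯 n)
  d_graded : ∀ n j, ∀ x ∈ 𝒯 (n + 1) j, (T.d (n + 1) n).hom x ∈ 𝒯 n j
  aug_graded : ∀ j ≠ 0, ∀ x ∈ 𝒯 0 j, (η.f 0).hom x = 0
  quasiIso : QuasiIso η
  minimal : ∀ n, LinearMap.range (T.d (n + 1) n).hom ≤ positivePart 𝒞 (T.X n)

end Gradings

section FreeComplex

variable {k : Type u} [Field k] {A : Type u} [Ring A] [Algebra k A]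

/-- A complex `⋯ → A ⊗ V₂ → A ⊗ V₁ → A` of free `A`-modules with finite dimensional graded `V_n`,
`V₀ = k`, augmented by `ε_A`. In coordinates, `V_n` has a basis of `rank n` homogeneous elements
of degrees `deg n i`. -/
structure FreeComplex (𝒜 : ℤ → Submodule k A) [GradedAlgebra 𝒜] [IsConnectedGraded 𝒜] where
  rank : ℕ → ℕ
  deg : ∀ n, Fin (rank n) → ℤ
  rank_zero : rank 0 = 1
  deg_zero : ∀ i, deg 0 i = 0
  d : ∀ n, (Fin (rank (n + 1)) → A) →ₗ[A] (Fin (rank n) → A)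
  d_comp_d : ∀ n, d n ∘ₗ d (n + 1) = 0
  aug_d : ∀ x, ∑ i, augmentation 𝒜 (d 0 x i) = 0

namespace FreeComplex

variable {𝒜 : ℤ → Submodule k A} [GradedAlgebra 𝒜] [IsConnectedGraded 𝒜] (P : FreeComplex 𝒜)

/-- The underlying complex of `A`-modules. -/
def complex : ChainComplex (ModuleCat.{u} A) ℕ :=
  ChainComplex.of (fun n => ModuleCat.of A (Fin (P.rank n) → A))
    (fun n => ModuleCat.ofHom (P.d n))
    (fun n => by rw [← ModuleCat.ofHom_comp, P.d_comp_d n]; rfl)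

/-- The grading on the terms of the complex. -/
def grading (n : ℕ) (j : ℤ) : AddSubgroup (P.complex.X n) :=
  (freeGrading 𝒜 (P.deg n) j).toAddSubgroup

/-- The augmentation `ε_A : A ⊗ V₀ = A → k`; the sum has only one term. -/
def aug₀ : (Fin (P.rank 0) → A) →ₗ[A] TrivialModule (augmentation 𝒜) where
  toFun x := ∑ i, augmentation 𝒜 (x i)
  map_add' x y := by
    have h : ∑ i, augmentation 𝒜 ((x + y) i) =
        ∑ i, augmentation 𝒜 (x i) + ∑ i, augmentation 𝒜 (y i) := by
      simp [Finset.sum_add_distrib]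
    exact h
  map_smul' a x := by
    have h : ∑ i, augmentation 𝒜 ((a • x) i) =
        augmentation 𝒜 a * ∑ i, augmentation 𝒜 (x i) := by
      simp [Finset.mul_sum]
    exact h

/-- The augmentation as a morphism of complexes. -/
def aug : P.complex ⟶ (ChainComplex.single₀ (ModuleCat.{u} A)).obj
    (ModuleCat.of A (TrivialModule (augmentation 𝒜))) :=
  (ChainComplex.toSingle₀Equiv _ _).symm ⟨ModuleCat.ofHom P.aug₀, by
    have h : P.complex.d 1 0 = ModuleCat.ofHom (P.d 0) :=
      ChainComplex.of_d (fun n => ModuleCat.of A (Fin (P.rank n) → A))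
        (fun n => ModuleCat.ofHom (P.d n)) 0
    rw [h]
    ext x
    exact P.aug_d x⟩

/-- The complex is a minimal free resolution of the trivial module. -/
def IsMinimalResolution : Prop :=
  IsMinimalFreeResolution 𝒜 (augmentation 𝒜) P.complex P.grading P.aug

/-- The complex is pure: each `V_n` is concentrated in one degree. -/
def IsPure : Prop := ∀ n, ∃ l : ℤ, ∀ i, P.deg n i = l

end FreeComplex

/-- A finite family of homogeneous elements which generates the algebra and no proper subfamily
of which does. -/
def IsMinimalGeneratingSet (𝒜 : ℤ → Submodule k A) {m : ℕ} (y : Fin m → A) : Prop :=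
  (∀ i, ∃ j, y i ∈ 𝒜 j) ∧ Algebra.adjoin k (Set.range y) = ⊤ ∧
    ∀ i, Algebra.adjoin k (y '' {i}ᶜ) ≠ ⊤

end FreeComplex

/-! ## Twisted tensor products -/

section Twisted

variable {k : Type u} [Field k] {A B : Type u} [Ring A] [Algebra k A] [Ring B] [Algebra k B]

/-- The multiplication `(m_A ⊗ m_B) (id_A ⊗ τ ⊗ id_B)` on `A ⊗ B`. -/
def twistedMul (τ : B ⊗[k] A →ₗ[k] A ⊗[k] B) : (A ⊗[k] B) ⊗[k] (A ⊗[k] B) →ₗ[k] A ⊗[k] B :=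
  TensorProduct.map (LinearMap.mul' k A) (LinearMap.mul' k B) ∘ₗ
    (TensorProduct.assoc k A A (B ⊗[k] B)).symm.toLinearMap ∘ₗ
    LinearMap.lTensor A ((TensorProduct.assoc k A B B).toLinearMap ∘ₗ LinearMap.rTensor B τ ∘ₗ
      (TensorProduct.assoc k B A B).symm.toLinearMap) ∘ₗ
    (TensorProduct.assoc k A B (A ⊗[k] B)).toLinearMap

theorem twistedMul_tmul (τ : B ⊗[k] A →ₗ[k] A ⊗[k] B) (a a' : A) (b b' : B) :
    twistedMul τ ((a ⊗ₜ b) ⊗ₜ (a' ⊗ₜ b')) =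
      TensorProduct.map (LinearMap.mulLeft k a) (LinearMap.mulRight k b') (τ (b ⊗ₜ a')) := by
  simp only [twistedMul, LinearMap.comp_apply, LinearEquiv.coe_coe, TensorProduct.assoc_tmul,
    LinearMap.lTensor_tmul, TensorProduct.assoc_symm_tmul, LinearMap.rTensor_tmul]
  generalize τ (b ⊗ₜ a') = t
  induction t with
  | zero => simp
  | tmul x y => simp
  | add x y hx hy => simp only [map_add, add_tmul, tmul_add, hx, hy]

/-- A graded twisting map `τ : B ⊗ A → A ⊗ B`: a graded linear map for which the multiplication
above is associative and `1 ⊗ 1` is a unit. -/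
structure TwistingMap (𝒜 : ℤ → Submodule k A) (ℬ : ℤ → Submodule k B) where
  toLin : B ⊗[k] A →ₗ[k] A ⊗[k] B
  graded : ∀ n, ∀ t ∈ tensorGrading ℬ 𝒜 n, toLin t ∈ tensorGrading 𝒜 ℬ n
  assoc : ∀ x y z, twistedMul toLin (twistedMul toLin (x ⊗ₜ y) ⊗ₜ z) =
    twistedMul toLin (x ⊗ₜ twistedMul toLin (y ⊗ₜ z))
  one_mul : ∀ x, twistedMul toLin ((1 ⊗ₜ 1) ⊗ₜ x) = x
  mul_one : ∀ x, twistedMul toLin (x ⊗ₜ (1 ⊗ₜ 1)) = x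

variable {𝒜 : ℤ → Submodule k A} {ℬ : ℤ → Submodule k B}

namespace TwistingMap

variable (τ : TwistingMap 𝒜 ℬ)

theorem one_tmul (a : A) : τ.toLin (1 ⊗ₜ a) = a ⊗ₜ 1 := by
  have h := τ.one_mul (a ⊗ₜ 1)
  rw [twistedMul_tmul] at h
  simpa using h

theorem tmul_one (b : B) : τ.toLin (b ⊗ₜ 1) = 1 ⊗ₜ b := by
  have h := τ.mul_one (1 ⊗ₜ b)
  rw [twistedMul_tmul] at h
  simpa using h

end TwistingMap

section Augmentation

variable (𝒜 ℬ)
variable [GradedAlgebra 𝒜] [IsConnectedGraded 𝒜] [GradedAlgebra ℬ] [IsConnectedGraded ℬ]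

/-- `ε_A ⊗ ε_B` as a linear map on `A ⊗ B`. -/
def tensorAugmentation : A ⊗[k] B →ₗ[k] k :=
  LinearMap.mul' k k ∘ₗ
    TensorProduct.map (augmentation 𝒜).toLinearMap (augmentation ℬ).toLinearMap

theorem tensorAugmentation_tmul (a : A) (b : B) :
    tensorAugmentation 𝒜 ℬ (a ⊗ₜ b) = augmentation 𝒜 a * augmentation ℬ b := by
  simp [tensorAugmentation]

theorem augmentation_of_ne {i : ℤ} (hi : i ≠ 0) {a : A} (ha : a ∈ 𝒜 i) :
    augmentation 𝒜 a = 0 := augmentationLinear_of_ne 𝒜 hi ha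

theorem tensorAugmentation_of_ne {n : ℤ} (hn : n ≠ 0) {x : A ⊗[k] B}
    (hx : x ∈ tensorGrading 𝒜 ℬ n) : tensorAugmentation 𝒜 ℬ x = 0 := by
  suffices h : tensorGrading 𝒜 ℬ n ≤ LinearMap.ker (tensorAugmentation 𝒜 ℬ) from h hx
  refine iSup_le fun p => Submodule.map₂_le.2 fun a ha b hb => ?_
  rw [LinearMap.mem_ker, TensorProduct.mk_apply, tensorAugmentation_tmul]
  by_cases hp : p = 0
  · rw [augmentation_of_ne ℬ (i := n - p) (by omega) hb, mul_zero]
  · rw [augmentation_of_ne 𝒜 hp ha, zero_mul]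

variable {𝒜 ℬ}
variable (τ : TwistingMap 𝒜 ℬ)

theorem tensorAugmentation_twist (b : B) (a : A) :
    tensorAugmentation 𝒜 ℬ (τ.toLin (b ⊗ₜ a)) = augmentation ℬ b * augmentation 𝒜 a := by
  induction b using DirectSum.Decomposition.inductionOn ℬ with
  | zero => simp
  | add b b' h h' => simp only [add_tmul, map_add, add_mul, h, h']
  | @homogeneous i b =>
    induction a using DirectSum.Decomposition.inductionOn 𝒜 with
    | zero => simp
    | add a a' h h' => simp only [tmul_add, map_add, mul_add, h, h']
    | @homogeneous j a =>
      rcases lt_or_ge i 0 with hi | hi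
      · simp [eq_zero_of_neg ℬ hi b.2]
      rcases lt_or_ge j 0 with hj | hj
      · simp [eq_zero_of_neg 𝒜 hj a.2]
      by_cases h : i + j = 0
      · obtain rfl : i = 0 := by omega
        obtain ⟨c, hc⟩ := exists_algebraMap ℬ b.2
        rw [hc, Algebra.algebraMap_eq_smul_one, ← smul_tmul', map_smul, τ.one_tmul, map_smul,
          map_smul, tensorAugmentation_tmul]
        simp
      · have hmem : (b : B) ⊗ₜ[k] (a : A) ∈ tensorGrading ℬ 𝒜 (i + j) := by
          refine Submodule.mem_iSup_of_mem i ?_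
          refine Submodule.apply_mem_map₂ _ b.2 ?_
          rw [add_sub_cancel_left]
          exact a.2
        rw [tensorAugmentation_of_ne 𝒜 ℬ h (τ.graded _ _ hmem)]
        by_cases hi0 : i = 0
        · rw [augmentation_of_ne 𝒜 (i := j) (by omega) a.2, mul_zero]
        · rw [augmentation_of_ne ℬ hi0 b.2, zero_mul]

theorem tensorAugmentation_mul (x y : A ⊗[k] B) :
    tensorAugmentation 𝒜 ℬ (twistedMul τ.toLin (x ⊗ₜ y)) =
      tensorAugmentation 𝒜 ℬ x * tensorAugmentation 𝒜 ℬ y := by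
  induction x with
  | zero => simp
  | add x x' h h' => simp only [add_tmul, map_add, add_mul, h, h']
  | tmul a b =>
    induction y with
    | zero => simp
    | add y y' h h' => simp only [tmul_add, map_add, mul_add, h, h']
    | tmul a' b' =>
      rw [twistedMul_tmul, tensorAugmentation_tmul, tensorAugmentation_tmul]
      have key : ∀ t : A ⊗[k] B, tensorAugmentation 𝒜 ℬ
          (TensorProduct.map (LinearMap.mulLeft k a) (LinearMap.mulRight k b') t) =
          augmentation 𝒜 a * tensorAugmentation 𝒜 ℬ t * augmentation ℬ b' := by
        intro t
        induction t with
        | zero => simp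
        | add x y hx hy => rw [map_add, map_add, map_add, hx, hy]; ring
        | tmul x y =>
          rw [TensorProduct.map_tmul, LinearMap.mulLeft_apply, LinearMap.mulRight_apply,
            tensorAugmentation_tmul, tensorAugmentation_tmul, map_mul, map_mul]
          ring
      rw [key, tensorAugmentation_twist]
      ring

end Augmentation

/-- The twisted tensor product `A ⊗^τ B`; its underlying vector space is `A ⊗ B`. -/
@[nolint unusedArguments]
def TwistedTensor (_τ : TwistingMap 𝒜 ℬ) : Type u := A ⊗[k] B

namespace TwistedTensor

variable (τ : TwistingMap 𝒜 ℬ)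

instance : AddCommGroup (TwistedTensor τ) := inferInstanceAs (AddCommGroup (A ⊗[k] B))
instance : Module k (TwistedTensor τ) := inferInstanceAs (Module k (A ⊗[k] B))

/-- The identity map from `A ⊗ B` to `A ⊗^τ B`. -/
def of : A ⊗[k] B ≃ₗ[k] TwistedTensor τ := LinearEquiv.refl k (A ⊗[k] B)

instance : Mul (TwistedTensor τ) where
  mul x y := of τ (twistedMul τ.toLin ((of τ).symm x ⊗ₜ[k] (of τ).symm y))

instance : One (TwistedTensor τ) where
  one := of τ (1 ⊗ₜ 1)

theorem mul_def (x y : TwistedTensor τ) :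
    x * y = of τ (twistedMul τ.toLin ((of τ).symm x ⊗ₜ[k] (of τ).symm y)) := rfl

theorem one_def : (1 : TwistedTensor τ) = of τ (1 ⊗ₜ 1) := rfl

instance : Ring (TwistedTensor τ) where
  __ := (inferInstance : AddCommGroup (TwistedTensor τ))
  mul_assoc x y z := by simp only [mul_def, LinearEquiv.symm_apply_apply, τ.assoc]
  one_mul x := by simp only [mul_def, one_def, LinearEquiv.symm_apply_apply, τ.one_mul,
    LinearEquiv.apply_symm_apply]
  mul_one x := by simp only [mul_def, one_def, LinearEquiv.symm_apply_apply, τ.mul_one,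
    LinearEquiv.apply_symm_apply]
  left_distrib x y z := by simp only [mul_def, map_add, tmul_add]
  right_distrib x y z := by simp only [mul_def, map_add, add_tmul]
  zero_mul x := by simp only [mul_def, map_zero, zero_tmul]
  mul_zero x := by simp only [mul_def, map_zero, tmul_zero]

instance : Algebra k (TwistedTensor τ) :=
  Algebra.ofModule
    (fun r x y => by simp only [mul_def, map_smul, ← smul_tmul'])
    (fun r x y => by simp only [mul_def, map_smul, tmul_smul])

/-- The grading of `A ⊗^τ B`, which is that of `A ⊗ B`. -/
def grading (n : ℤ) : Submodule k (TwistedTensor τ) :=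
  (tensorGrading 𝒜 ℬ n).map (of τ).toLinearMap

/-- The inclusion `ι_A : A → A ⊗^τ B`, `a ↦ a ⊗^τ 1`. -/
def inclA : A →ₐ[k] TwistedTensor τ :=
  AlgHom.ofLinearMap ((of τ).toLinearMap ∘ₗ (TensorProduct.mk k A B).flip 1) rfl (fun a a' => by
    simp only [mul_def, LinearMap.comp_apply, LinearMap.flip_apply, TensorProduct.mk_apply,
      LinearEquiv.coe_coe, LinearEquiv.symm_apply_apply, twistedMul_tmul, τ.one_tmul,
      TensorProduct.map_tmul, LinearMap.mulLeft_apply, LinearMap.mulRight_apply, _root_.mul_one])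

/-- The augmentation `ε_C = ε_A ⊗ ε_B` of `C = A ⊗^τ B`. -/
def aug [GradedAlgebra 𝒜] [IsConnectedGraded 𝒜] [GradedAlgebra ℬ] [IsConnectedGraded ℬ] :
    TwistedTensor τ →ₐ[k] k :=
  AlgHom.ofLinearMap (tensorAugmentation 𝒜 ℬ ∘ₗ (of τ).symm.toLinearMap)
    (by simp [one_def, tensorAugmentation_tmul])
    (fun x y => by simp [mul_def, tensorAugmentation_mul])

end TwistedTensor

end Twisted

/-! ## The tensor product of a bimodule with a left module -/

section Balanced

variable {k : Type u} [Field k] {A C : Type u} [Ring A] [Algebra k A] [Ring C] [Algebra k C]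

variable {M M' N N' : Type u}
  [AddCommGroup M] [Module k M] [Module C M] [IsScalarTower k C M]
  [AddCommGroup M'] [Module k M'] [Module C M'] [IsScalarTower k C M']
  [AddCommGroup N] [Module k N] [Module A N] [IsScalarTower k A N]
  [AddCommGroup N'] [Module k N'] [Module A N'] [IsScalarTower k A N']

variable (k N) in
/-- The relations `(m * a) ⊗ n - m ⊗ (a n)` of the tensor product over `A`. Here `M` is a
`(C, A)`-bimodule: a left `C`-module with a right action `ρ` of `A` by `C`-linear maps. -/
def balancedRelations (ρ : Aᵐᵒᵖ →+* Module.End C M) : Submodule C (M ⊗[k] N) :=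
  Submodule.span C {z | ∃ (m : M) (a : A) (n : N),
    z = ρ (MulOpposite.op a) m ⊗ₜ n - m ⊗ₜ (a • n)}

variable (k N) in
/-- The left `C`-module `M ⊗_A N` for a `(C, A)`-bimodule `M` and a left `A`-module `N`. -/
abbrev Balanced (ρ : Aᵐᵒᵖ →+* Module.End C M) : Type u :=
  (M ⊗[k] N) ⧸ balancedRelations k N ρ

/-- The map `f ⊗_A g` for a bimodule homomorphism `f` and a module homomorphism `g`. -/
def Balanced.map (ρ : Aᵐᵒᵖ →+* Module.End C M) (ρ' : Aᵐᵒᵖ →+* Module.End C M')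
    (f : M →ₗ[C] M') (hf : ∀ a x, f (ρ a x) = ρ' a (f x)) (g : N →ₗ[A] N') :
    Balanced k N ρ →ₗ[C] Balanced k N' ρ' :=
  Submodule.mapQ _ _ (AlgebraTensorModule.map f (g.restrictScalars k)) (by
    refine Submodule.span_le.2 ?_
    rintro _ ⟨m, a, n, rfl⟩
    refine Submodule.subset_span ⟨f m, a, g n, ?_⟩
    simp [hf])

theorem Balanced.map_mk (ρ : Aᵐᵒᵖ →+* Module.End C M) (ρ' : Aᵐᵒᵖ →+* Module.End C M')
    (f : M →ₗ[C] M') (hf : ∀ a x, f (ρ a x) = ρ' a (f x)) (g : N →ₗ[A] N') (m : M) (n : N) :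
    Balanced.map (k := k) ρ ρ' f hf g (Submodule.Quotient.mk (m ⊗ₜ n)) =
      Submodule.Quotient.mk (f m ⊗ₜ g n) := rfl

theorem Balanced.ext {ρ : Aᵐᵒᵖ →+* Module.End C M} {X : Type u} [AddCommGroup X] [Module C X]
    {f g : Balanced k N ρ →ₗ[C] X}
    (h : ∀ m n, f (Submodule.Quotient.mk (m ⊗ₜ n)) = g (Submodule.Quotient.mk (m ⊗ₜ n))) :
    f = g := by
  refine Submodule.linearMap_qext _ (LinearMap.ext fun t => ?_)
  induction t with
  | zero => simp
  | add x y hx hy => rw [map_add, map_add, hx, hy]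
  | tmul m n => exact h m n

/-- The grading of `M ⊗_A N` induced by gradings of `M` and `N`. -/
def balancedGrading (ρ : Aᵐᵒᵖ →+* Module.End C M) (ℳ : ℤ → Submodule k M)
    (𝒩 : ℤ → Submodule k N) (j : ℤ) : Submodule k (Balanced k N ρ) :=
  (tensorGrading ℳ 𝒩 j).map ((balancedRelations k N ρ).mkQ.restrictScalars k)

end Balanced

/-! ## The complex `F = A ⊗^τ Q` and its bimodule structures -/

section Resolution

variable {k : Type u} [Field k] {A B : Type u} [Ring A] [Algebra k A] [Ring B] [Algebra k B]
variable {𝒜 : ℤ → Submodule k A} {ℬ : ℤ → Submodule k B}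
variable (τ : TwistingMap 𝒜 ℬ)

/-- The identification of `A ⊗^τ (B ⊗ W)` with `C ⊗ W`, where `C = A ⊗^τ B`, in coordinates. -/
def inducedEquiv (r : ℕ) : A ⊗[k] (Fin r → B) ≃ₗ[k] (Fin r → TwistedTensor τ) :=
  TensorProduct.piRight k k A (fun _ : Fin r => B) ≪≫ₗ
    LinearEquiv.piCongrRight fun _ => TwistedTensor.of τ

theorem inducedEquiv_tmul {r : ℕ} (a : A) (q : Fin r → B) (i : Fin r) :
    inducedEquiv τ r (a ⊗ₜ q) i = TwistedTensor.of τ (a ⊗ₜ q i) := by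
  simp [inducedEquiv]

/-- Under the identification, the action of `C` on `A ⊗^τ (B ⊗ W)` is
`(m_A ⊗ λ) (id_A ⊗ τ ⊗ id)`, where `λ` is the action of `B`. -/
theorem smul_inducedEquiv {r : ℕ} (a a' : A) (b : B) (q : Fin r → B) :
    TwistedTensor.of τ (a ⊗ₜ b) • inducedEquiv τ r (a' ⊗ₜ q) =
      inducedEquiv τ r (TensorProduct.map (LinearMap.mulLeft k a)
        ((LinearMap.toSpanSingleton B (Fin r → B) q).restrictScalars k) (τ.toLin (b ⊗ₜ a'))) := by
  ext i
  rw [Pi.smul_apply, smul_eq_mul, inducedEquiv_tmul, TwistedTensor.mul_def]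
  simp only [LinearEquiv.symm_apply_apply, twistedMul_tmul]
  generalize τ.toLin (b ⊗ₜ a') = t
  induction t with
  | zero => simp
  | add x y hx hy => simp only [map_add, Pi.add_apply, hx, hy]
  | tmul x y => simp [inducedEquiv_tmul]

/-- The `C`-linear map `A ⊗^τ f : A ⊗^τ (B ⊗ W) → A ⊗^τ (B ⊗ W')`, which is `id_A ⊗ f` on
underlying vector spaces. -/
def inducedMap {r s : ℕ} (f : (Fin r → B) →ₗ[B] (Fin s → B)) :
    (Fin r → TwistedTensor τ) →ₗ[TwistedTensor τ] (Fin s → TwistedTensor τ) where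
  toFun x := inducedEquiv τ s (LinearMap.lTensor A (f.restrictScalars k)
    ((inducedEquiv τ r).symm x))
  map_add' x y := by simp only [map_add]
  map_smul' c x := by
    obtain ⟨x, rfl⟩ := (inducedEquiv τ r).surjective x
    obtain ⟨c, rfl⟩ := (TwistedTensor.of τ).surjective c
    simp only [LinearEquiv.symm_apply_apply, RingHom.id_apply]
    induction x with
    | zero => simp
    | add x y hx hy => simp only [map_add, smul_add, hx, hy]
    | tmul a' q =>
      induction c with
      | zero => simp
      | add c c' h h' => simp only [map_add, add_smul, h, h']
      | tmul a b =>
        rw [smul_inducedEquiv, LinearEquiv.symm_apply_apply, LinearMap.lTensor_tmul,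
          smul_inducedEquiv]
        congr 1
        generalize τ.toLin (b ⊗ₜ a') = t
        induction t with
        | zero => simp
        | add x y hx hy => simp only [map_add, hx, hy]
        | tmul x y => simp

theorem inducedMap_inducedEquiv {r s : ℕ} (f : (Fin r → B) →ₗ[B] (Fin s → B))
    (x : A ⊗[k] (Fin r → B)) : inducedMap τ f (inducedEquiv τ r x) =
      inducedEquiv τ s (LinearMap.lTensor A (f.restrictScalars k) x) := by
  simp [inducedMap]

/-- The right action of `A` on the `φ`-twisted module `(C ⊗ W)^φ`, for an algebra homomorphism
`φ : A → M_r(A)`: `(∑ x_i ⊗ e_i) * a = ∑_j (∑_i x_i φ_{ij}(a)) ⊗ e_j`. -/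
def twistedRight {r : ℕ} (φ : A →ₐ[k] Matrix (Fin r) (Fin r) A) :
    Aᵐᵒᵖ →+* Module.End (TwistedTensor τ) (Fin r → TwistedTensor τ) where
  toFun a := Matrix.vecMulLinear ((φ a.unop).map (TwistedTensor.inclA τ))
  map_one' := by
    refine LinearMap.ext fun x => ?_
    simp
  map_mul' a b := by
    refine LinearMap.ext fun x => ?_
    simp [Matrix.map_mul]
  map_zero' := by
    refine LinearMap.ext fun x => ?_
    simp
  map_add' a b := by
    refine LinearMap.ext fun x => ?_
    simp [Matrix.map_add]

variable [GradedAlgebra 𝒜] [IsConnectedGraded 𝒜] [GradedAlgebra ℬ] [IsConnectedGraded ℬ]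

/-- The data turning `F = A ⊗^τ Q` into the complex
`F_φ = (⋯ → (C ⊗ W₂)^{φ₂} → (C ⊗ W₁)^σ → C)` of graded `(C, A)`-bimodules: graded algebra
homomorphisms `φ_n`, with `φ₀ = id` and `φ₁ = σ`, for which the differentials `A ⊗^τ d_Q` are
right `A`-linear. -/
structure BimoduleTwist (Q : FreeComplex ℬ) {m : ℕ} (hm : Q.rank 1 = m)
    (σ : A →ₐ[k] Matrix (Fin m) (Fin m) A) where
  φ : ∀ n, A →ₐ[k] Matrix (Fin (Q.rank n)) (Fin (Q.rank n)) A
  φ_graded : ∀ n j, ∀ a ∈ 𝒜 j, ∀ p q, φ n a p q ∈ 𝒜 j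
  φ_zero : ∀ a, φ 0 a = Matrix.diagonal fun _ => a
  φ_one : ∀ a p q, φ 1 a p q = σ a (Fin.cast hm p) (Fin.cast hm q)
  d_right : ∀ n a x, inducedMap τ (Q.d n) (twistedRight τ (φ (n + 1)) a x) =
    twistedRight τ (φ n) a (inducedMap τ (Q.d n) x)

/-- The augmentation of `C ⊗ W₀ = C`; the sum has only one term. -/
def inducedAug (Q : FreeComplex ℬ) (x : Fin (Q.rank 0) → TwistedTensor τ) : k :=
  ∑ i, TwistedTensor.aug τ (x i)

theorem aug_of (a : A) (b : B) : TwistedTensor.aug τ (TwistedTensor.of τ (a ⊗ₜ b)) =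
    augmentation 𝒜 a * augmentation ℬ b := by
  simp [TwistedTensor.aug, tensorAugmentation_tmul]

theorem inducedAug_d (Q : FreeComplex ℬ) (x : Fin (Q.rank 1) → TwistedTensor τ) :
    inducedAug τ Q (inducedMap τ (Q.d 0) x) = 0 := by
  obtain ⟨x, rfl⟩ := (inducedEquiv τ _).surjective x
  rw [inducedMap_inducedEquiv]
  induction x with
  | zero => simp [inducedAug]
  | add x y hx hy =>
    simp only [inducedAug, map_add, Pi.add_apply, Finset.sum_add_distrib] at hx hy ⊢
    rw [hx, hy, add_zero]
  | tmul a q =>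
    simp only [inducedAug, LinearMap.lTensor_tmul, inducedEquiv_tmul, aug_of, ← Finset.mul_sum,
      LinearMap.coe_restrictScalars]
    rw [Q.aug_d q, mul_zero]

namespace BimoduleTwist

variable {τ}
variable {Q : FreeComplex ℬ} {m : ℕ} {hm : Q.rank 1 = m} {σ : A →ₐ[k] Matrix (Fin m) (Fin m) A}
variable (Φ : BimoduleTwist τ Q hm σ) (P : FreeComplex 𝒜)

/-- The `C`-module `F_p ⊗_A P_q`. -/
abbrev Piece (p q : ℕ) : Type u :=
  Balanced k (Fin (P.rank q) → A) (twistedRight τ (Φ.φ p))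

/-- The map `d_F ⊗_A id`. -/
def dLeft (p q : ℕ) : Φ.Piece P (p + 1) q →ₗ[TwistedTensor τ] Φ.Piece P p q :=
  Balanced.map _ _ (inducedMap τ (Q.d p)) (fun a x => Φ.d_right p a x) LinearMap.id

/-- The map `id ⊗_A d_P`. -/
def dRight (p q : ℕ) : Φ.Piece P p (q + 1) →ₗ[TwistedTensor τ] Φ.Piece P p q :=
  Balanced.map _ _ LinearMap.id (fun _ _ => rfl) (P.d q)

/-- The term `⨁_{p + q = n} F_p ⊗_A P_q` of the tensor product complex. -/
abbrev Term (n : ℕ) : Type u :=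
  ∀ s : {s : ℕ × ℕ // s.1 + s.2 = n}, Φ.Piece P s.1.1 s.1.2

/-- The differential `d (y ⊗ x) = d y ⊗ x + (-1)^p y ⊗ d x` for `y ∈ F_p`. -/
def d (n : ℕ) : Φ.Term P (n + 1) →ₗ[TwistedTensor τ] Φ.Term P n :=
  LinearMap.pi fun s =>
    Φ.dLeft P s.1.1 s.1.2 ∘ₗ
      LinearMap.proj (φ := fun s : {s : ℕ × ℕ // s.1 + s.2 = n + 1} => Φ.Piece P s.1.1 s.1.2)
        ⟨(s.1.1 + 1, s.1.2), by have := s.2; grind⟩ +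
    (-1 : ℤ) ^ s.1.1 • (Φ.dRight P s.1.1 s.1.2 ∘ₗ
      LinearMap.proj (φ := fun s : {s : ℕ × ℕ // s.1 + s.2 = n + 1} => Φ.Piece P s.1.1 s.1.2)
        ⟨(s.1.1, s.1.2 + 1), by have := s.2; grind⟩)

theorem dLeft_dLeft (p q : ℕ) : Φ.dLeft P p q ∘ₗ Φ.dLeft P (p + 1) q = 0 := by
  refine Balanced.ext fun x y => ?_
  have h : inducedMap τ (Q.d p) (inducedMap τ (Q.d (p + 1)) x) = 0 := by
    obtain ⟨x, rfl⟩ := (inducedEquiv τ _).surjective x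
    rw [inducedMap_inducedEquiv, inducedMap_inducedEquiv, ← LinearMap.comp_apply,
      ← LinearMap.lTensor_comp, ← LinearMap.restrictScalars_comp, Q.d_comp_d]
    simp
  simp only [LinearMap.comp_apply, dLeft, Balanced.map_mk, h, zero_tmul, LinearMap.zero_apply]
  rfl

theorem dRight_dRight (p q : ℕ) : Φ.dRight P p q ∘ₗ Φ.dRight P p (q + 1) = 0 := by
  refine Balanced.ext fun x y => ?_
  have h : P.d q (P.d (q + 1) y) = 0 := LinearMap.congr_fun (P.d_comp_d q) y
  simp only [LinearMap.comp_apply, dRight, Balanced.map_mk, h, tmul_zero, LinearMap.zero_apply]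
  rfl

theorem dLeft_dRight (p q : ℕ) :
    Φ.dLeft P p q ∘ₗ Φ.dRight P (p + 1) q = Φ.dRight P p q ∘ₗ Φ.dLeft P p (q + 1) :=
  Balanced.ext fun _ _ => rfl

theorem d_comp_d (n : ℕ) : Φ.d P n ∘ₗ Φ.d P (n + 1) = 0 := by
  refine LinearMap.ext fun x => funext fun s => ?_
  obtain ⟨⟨p, q⟩, hs⟩ := s
  have h1 := LinearMap.congr_fun (Φ.dLeft_dLeft P p q)
  have h2 := LinearMap.congr_fun (Φ.dRight_dRight P p q)
  have h3 := LinearMap.congr_fun (Φ.dLeft_dRight P p q)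
  simp only [LinearMap.comp_apply, LinearMap.zero_apply] at h1 h2 h3
  simp only [d, LinearMap.comp_apply, LinearMap.pi_apply, LinearMap.add_apply,
    LinearMap.smul_apply, LinearMap.proj_apply, map_add, map_zsmul, h1, h2, h3,
    smul_zero, zero_add, add_zero, pow_succ, LinearMap.zero_apply, Pi.zero_apply]
  simp

/-- The complex `F_φ ⊗_A P` of `C`-modules. -/
def complex : ChainComplex (ModuleCat.{u} (TwistedTensor τ)) ℕ :=
  ChainComplex.of (fun n => ModuleCat.of (TwistedTensor τ) (Φ.Term P n))
    (fun n => ModuleCat.ofHom (Φ.d P n))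
    (fun n => by rw [← ModuleCat.ofHom_comp, Φ.d_comp_d P n]; rfl)

/-- The grading on the terms of `F_φ ⊗_A P`. -/
def grading (n : ℕ) (j : ℤ) : AddSubgroup ((Φ.complex P).X n) :=
  (Submodule.pi Set.univ fun s : {s : ℕ × ℕ // s.1 + s.2 = n} =>
    balancedGrading (twistedRight τ (Φ.φ s.1.1))
      (freeGrading (TwistedTensor.grading τ) (Q.deg s.1.1))
      (freeGrading 𝒜 (P.deg s.1.2)) j).toAddSubgroup

/-- The bilinear map underlying the augmentation, `(x, y) ↦ ε_C(x) ε_A(y)` for `x ∈ C ⊗ W₀ = C`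
and `y ∈ A ⊗ V₀ = A`. -/
def augTensor : (Fin (Q.rank 0) → TwistedTensor τ) ⊗[k] (Fin (P.rank 0) → A)
    →ₗ[TwistedTensor τ] TrivialModule (TwistedTensor.aug τ) :=
  AlgebraTensorModule.lift
    { toFun := fun x =>
        { toFun := fun y => (show k from inducedAug τ Q x * ∑ i, augmentation 𝒜 (y i))
          map_add' := fun y y' => by
            have h : inducedAug τ Q x * ∑ i, augmentation 𝒜 ((y + y') i) =
                inducedAug τ Q x * ∑ i, augmentation 𝒜 (y i) +
                  inducedAug τ Q x * ∑ i, augmentation 𝒜 (y' i) := by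
              simp [Finset.sum_add_distrib, mul_add]
            exact h
          map_smul' := fun c y => by
            have h : inducedAug τ Q x * ∑ i, augmentation 𝒜 ((c • y) i) =
                c * (inducedAug τ Q x * ∑ i, augmentation 𝒜 (y i)) := by
              simp [← Finset.mul_sum, mul_left_comm]
            exact h }
      map_add' := fun x x' => LinearMap.ext fun y => by
        have h : inducedAug τ Q (x + x') * ∑ i, augmentation 𝒜 (y i) =
            inducedAug τ Q x * ∑ i, augmentation 𝒜 (y i) +
              inducedAug τ Q x' * ∑ i, augmentation 𝒜 (y i) := by
          simp [inducedAug, Finset.sum_add_distrib, add_mul]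
        exact h
      map_smul' := fun c x => LinearMap.ext fun y => by
        have h : inducedAug τ Q (c • x) * ∑ i, augmentation 𝒜 (y i) =
            TwistedTensor.aug τ c * (inducedAug τ Q x * ∑ i, augmentation 𝒜 (y i)) := by
          simp [inducedAug, ← Finset.mul_sum, mul_assoc]
        exact h }

theorem augTensor_tmul (x : Fin (Q.rank 0) → TwistedTensor τ) (y : Fin (P.rank 0) → A) :
    augTensor (τ := τ) (Q := Q) P (x ⊗ₜ y) =
      (show k from inducedAug τ Q x * ∑ i, augmentation 𝒜 (y i)) := rfl

/-- The augmentation `ε_C : F₀ ⊗_A P₀ = C ⊗_A A = C → k`. -/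
def aug₀₀ : Φ.Piece P 0 0 →ₗ[TwistedTensor τ] TrivialModule (TwistedTensor.aug τ) :=
  Submodule.liftQ _ (augTensor P) (by
    refine Submodule.span_le.2 ?_
    rintro _ ⟨x, a, y, rfl⟩
    change augTensor P _ = 0
    rw [map_sub]
    refine sub_eq_zero.2 ?_
    have h : inducedAug τ Q (twistedRight τ (Φ.φ 0) (MulOpposite.op a) x) =
        inducedAug τ Q x * augmentation 𝒜 a := by
      have ha : TwistedTensor.aug τ (TwistedTensor.inclA τ a) = augmentation 𝒜 a := by
        change TwistedTensor.aug τ (TwistedTensor.of τ (a ⊗ₜ 1)) = _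
        rw [aug_of, map_one, mul_one]
      simp [inducedAug, twistedRight, Φ.φ_zero, Matrix.diagonal_map, Matrix.vecMul_diagonal, ha,
        Finset.sum_mul]
    have h' : inducedAug τ Q (twistedRight τ (Φ.φ 0) (MulOpposite.op a) x) *
        ∑ i, augmentation 𝒜 (y i) = inducedAug τ Q x * ∑ i, augmentation 𝒜 ((a • y) i) := by
      rw [h]
      simp [← Finset.mul_sum, mul_assoc]
    exact h')

/-- The augmentation on the term of degree zero. -/
def aug₀ : Φ.Term P 0 →ₗ[TwistedTensor τ] TrivialModule (TwistedTensor.aug τ) :=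
  Φ.aug₀₀ P ∘ₗ LinearMap.proj
    (φ := fun s : {s : ℕ × ℕ // s.1 + s.2 = 0} => Φ.Piece P s.1.1 s.1.2) ⟨(0, 0), rfl⟩

theorem aug₀_d (x : Φ.Term P 1) : Φ.aug₀ P (Φ.d P 0 x) = 0 := by
  have h1 : Φ.aug₀₀ P ∘ₗ Φ.dLeft P 0 0 = 0 := by
    refine Balanced.ext fun x y => ?_
    have h : inducedAug τ Q (inducedMap τ (Q.d 0) x) * ∑ i, augmentation 𝒜 (y i) = 0 := by
      rw [inducedAug_d, zero_mul]
    exact h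
  have h2 : Φ.aug₀₀ P ∘ₗ Φ.dRight P 0 0 = 0 := by
    refine Balanced.ext fun x y => ?_
    have h : inducedAug τ Q x * ∑ i, augmentation 𝒜 (P.d 0 y i) = 0 := by
      rw [P.aug_d, mul_zero]
    exact h
  have h1' := LinearMap.congr_fun h1
  have h2' := LinearMap.congr_fun h2
  simp only [LinearMap.comp_apply, LinearMap.zero_apply] at h1' h2'
  simp only [aug₀, d, LinearMap.comp_apply, LinearMap.pi_apply, LinearMap.add_apply,
    LinearMap.smul_apply, LinearMap.proj_apply, map_add, map_zsmul, h1', h2', smul_zero,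
    add_zero]

/-- The augmentation `ε_C : F_φ ⊗_A P → k` as a morphism of complexes. -/
def aug : Φ.complex P ⟶ (ChainComplex.single₀ (ModuleCat.{u} (TwistedTensor τ))).obj
    (ModuleCat.of (TwistedTensor τ) (TrivialModule (TwistedTensor.aug τ))) :=
  (ChainComplex.toSingle₀Equiv _ _).symm ⟨ModuleCat.ofHom (Φ.aug₀ P), by
    have h : (Φ.complex P).d 1 0 = ModuleCat.ofHom (Φ.d P 0) :=
      ChainComplex.of_d (fun n => ModuleCat.of (TwistedTensor τ) (Φ.Term P n))
        (fun n => ModuleCat.ofHom (Φ.d P n)) 0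
    rw [h]
    ext x
    exact Φ.aug₀_d P x⟩

end BimoduleTwist

end Resolution

end TwistedResolution

open TwistedResolution

namespace TwistedResolution

/-! ## Quasi-isomorphisms to a complex concentrated in degree zero -/

/-! The argument rests on the inclusion τ(B_i ⊗ A_s) ⊆ A_s ⊗ B_i (`PreservesBidegree`), which is
finer than gradedness of τ. Purity puts all y_i in one degree, where τ = (σ, 0) gives the inclusion
directly; associativity of C = A ⊗^τ B carries it to products, and the y_i generate B
(`preservesBidegree_of_generators`).

Existence of the φ_n. The pair φ₀ = id, φ₁ = σ is compatible with the first differential because y_i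
a = ∑ σ_it(a) y_t in C. Given φ_n with n ≥ 1, let E_i be the image in F_n of the i-th basis vector
of F_{n+1}. Its coordinates lie in B_u with u = l_{n+1} - l_n, and E_i * a is again a cycle, with
coordinates in A ⊗ B_u. Exactness of Q shows that the cycles with coordinates in B_u are the images
of scalar vectors, and minimality of Q makes scalar vectors embed. Hence E_i * a = ∑ ψ_ij(a) E_j
with unique coefficients, and uniqueness makes ψ an algebra homomorphism (`exists_twist`).

Homology. Since A is flat over the field k, A ⊗^τ Q resolves A through id_A ⊗ ε_B, and this map is
right A-linear by the bidegree property. As P_q is free, F_φ ⊗_A P_q is a finite direct sum of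
copies of F, so it resolves P_q. The total complex therefore has the homology of P, namely k. In
place of a spectral sequence there is a chase along the antidiagonals (`exists_d_eq_of_vanish`,
`exact_d`, `exact_aug₀`).

Degrees and minimality. In coordinates the differential multiplies by entries of d_Q and by entries
of φ_p applied to entries of d_P. All of them are killed by the augmentation, because P and Q are
minimal and φ_p preserves degrees. Purity enters again here: φ_p mixes the basis vectors of W_p, so
these must share a degree for the right action to be graded. -/

/-- The target has no homology in positive degrees, so there the condition is exactness of the
source; in degree zero it says that `η` induces an isomorphism from the cokernel of the last
differential. -/
theorem quasiIso_single₀_iff {R : Type u} [Ring R] {T : ChainComplex (ModuleCat.{u} R) ℕ}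
    {X : ModuleCat.{u} R} (η : T ⟶ (ChainComplex.single₀ (ModuleCat.{u} R)).obj X) :
    QuasiIso η ↔ (∀ n, Function.Exact (T.d (n + 2) (n + 1)).hom (T.d (n + 1) n).hom) ∧
      Function.Exact (T.d 1 0).hom (η.f 0).hom ∧ Function.Surjective (η.f 0).hom := by
  rw [quasiIso_iff]
  have h0 : QuasiIsoAt η 0 ↔ Function.Exact (T.d 1 0).hom (η.f 0).hom ∧
      Function.Surjective (η.f 0).hom := by
    rw [ChainComplex.quasiIsoAt₀_iff, ShortComplex.quasiIso_iff_of_zeros' _ (by simp; rfl) rfl rfl,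
      ShortComplex.ShortExact.moduleCat_exact_iff_function_exact, ModuleCat.epi_iff_surjective]
    rfl
  have h1 (n : ℕ) : QuasiIsoAt η (n + 1) ↔
      Function.Exact (T.d (n + 2) (n + 1)).hom (T.d (n + 1) n).hom := by
    rw [quasiIsoAt_iff_exactAt' η (n + 1) (ChainComplex.exactAt_succ_single_obj _ _),
      HomologicalComplex.exactAt_iff' _ (n + 2) (n + 1) n (by simp) (by simp),
      ShortComplex.ShortExact.moduleCat_exact_iff_function_exact]
    rfl
  constructor
  · exact fun h => ⟨fun n => (h1 n).1 (h (n + 1)), h0.1 (h 0)⟩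
  · rintro ⟨h, h'⟩ (_ | n)
    exacts [h0.2 h', (h1 n).2 (h n)]

/-! ## The augmentation and the homogeneous components -/

section Connected

variable {k : Type u} [Field k] {A : Type u} [Ring A] [Algebra k A]
variable (𝒜 : ℤ → Submodule k A) [GradedAlgebra 𝒜] [IsConnectedGraded 𝒜]

theorem augmentation_algebraMap (c : k) : augmentation 𝒜 (algebraMap k A c) = c :=
  augmentationLinear_algebraMap 𝒜 c

theorem decompose_zero_eq (a : A) :
    ((DirectSum.decompose 𝒜 a 0 : 𝒜 0) : A) = algebraMap k A (augmentation 𝒜 a) := by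
  induction a using DirectSum.Decomposition.inductionOn 𝒜 with
  | zero => simp
  | add a b ha hb => simp [ha, hb]
  | @homogeneous i a =>
    by_cases hi : i = 0
    · subst hi
      obtain ⟨c, hc⟩ := exists_algebraMap 𝒜 a.2
      rw [DirectSum.decompose_of_mem_same 𝒜 a.2, hc, augmentation_algebraMap]
    · rw [DirectSum.decompose_of_mem_ne 𝒜 a.2 hi, augmentation_of_ne 𝒜 hi a.2, map_zero]

theorem augmentation_eq_zero_of_mem_positivePart {r : ℕ} {x : Fin r → A}
    (hx : x ∈ positivePart 𝒜 (Fin r → A)) (i : Fin r) : augmentation 𝒜 (x i) = 0 := by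
  induction hx using Submodule.span_induction with
  | mem x hx =>
    obtain ⟨j, hj, c, hc, x, rfl⟩ := hx
    rw [Pi.smul_apply, smul_eq_mul, map_mul, augmentation_of_ne 𝒜 (by omega) hc, zero_mul]
  | zero => simp
  | add x y _ _ hx hy => rw [Pi.add_apply, map_add, hx, hy, add_zero]
  | smul a x _ hx => rw [Pi.smul_apply, smul_eq_mul, map_mul, hx, mul_zero]

end Connected

/-! ## Degrees in twisted tensor products -/

section Twisted

variable {k : Type u} [Field k] {A B : Type u} [Ring A] [Algebra k A] [Ring B] [Algebra k B]
variable {𝒜 : ℤ → Submodule k A} {ℬ : ℤ → Submodule k B} (τ : TwistingMap 𝒜 ℬ)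

namespace TwistedTensor

/-- The inclusion `ι_B : B → A ⊗^τ B`, `b ↦ 1 ⊗^τ b`. -/
def inclB : B →ₐ[k] TwistedTensor τ :=
  AlgHom.ofLinearMap ((of τ).toLinearMap ∘ₗ TensorProduct.mk k A B 1) rfl (fun b b' => by
    simp only [mul_def, LinearMap.comp_apply, TensorProduct.mk_apply,
      LinearEquiv.coe_coe, LinearEquiv.symm_apply_apply, twistedMul_tmul, τ.tmul_one,
      TensorProduct.map_tmul, LinearMap.mulLeft_apply, LinearMap.mulRight_apply, _root_.mul_one])

theorem inclA_apply (a : A) : inclA τ a = of τ (a ⊗ₜ 1) := rfl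

theorem inclB_apply (b : B) : inclB τ b = of τ (1 ⊗ₜ b) := rfl

theorem inclA_mul_inclB (a : A) (b : B) : inclA τ a * inclB τ b = of τ (a ⊗ₜ b) := by
  simp only [mul_def, inclA_apply, inclB_apply, LinearEquiv.symm_apply_apply, twistedMul_tmul,
    τ.one_tmul, TensorProduct.map_tmul, LinearMap.mulLeft_apply, LinearMap.mulRight_apply,
    _root_.mul_one, _root_.one_mul]

theorem inclB_mul_inclA (b : B) (a : A) : inclB τ b * inclA τ a = of τ (τ.toLin (b ⊗ₜ a)) := by
  simp only [mul_def, inclA_apply, inclB_apply, LinearEquiv.symm_apply_apply, twistedMul_tmul,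
    LinearMap.mulLeft_one, LinearMap.mulRight_one, TensorProduct.map_id, LinearMap.id_apply]

@[elab_as_elim]
theorem induction_on {p : TwistedTensor τ → Prop} (c : TwistedTensor τ)
    (mul : ∀ a b, p (inclA τ a * inclB τ b)) (add : ∀ x y, p x → p y → p (x + y)) : p c := by
  obtain ⟨c, rfl⟩ := (of τ).surjective c
  induction c with
  | zero => simpa using mul 0 0
  | tmul a b => exact inclA_mul_inclB τ a b ▸ mul a b
  | add x y hx hy => rw [map_add]; exact add _ _ hx hy

/-- The subspace `A_s ⊗ B_i` of `A ⊗^τ B`. -/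
def bidegree (s i : ℤ) : Submodule k (TwistedTensor τ) :=
  (𝒜 s).map (inclA τ).toLinearMap * (ℬ i).map (inclB τ).toLinearMap

variable {τ} in
theorem mul_mem_bidegree {s i : ℤ} {a : A} {b : B} (ha : a ∈ 𝒜 s) (hb : b ∈ ℬ i) :
    inclA τ a * inclB τ b ∈ bidegree τ s i :=
  Submodule.mul_mem_mul ⟨a, ha, rfl⟩ ⟨b, hb, rfl⟩

variable {τ} in
theorem bidegree_induction {s i : ℤ} {p : TwistedTensor τ → Prop}
    (mul : ∀ a ∈ 𝒜 s, ∀ b ∈ ℬ i, p (inclA τ a * inclB τ b))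
    (add : ∀ x y, p x → p y → p (x + y)) {c : TwistedTensor τ} (hc : c ∈ bidegree τ s i) :
    p c := by
  refine Submodule.mul_induction_on hc ?_ add
  rintro _ ⟨a, ha, rfl⟩ _ ⟨b, hb, rfl⟩
  exact mul a ha b hb

theorem grading_eq_iSup (n : ℤ) : grading τ n = ⨆ s, bidegree τ s (n - s) := by
  rw [grading, tensorGrading, Submodule.map_iSup]
  refine iSup_congr fun s => le_antisymm ?_ ?_
  · rw [Submodule.map_le_iff_le_comap]
    refine Submodule.map₂_le.2 fun a ha b hb => ?_
    change of τ (a ⊗ₜ b) ∈ _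
    rw [← inclA_mul_inclB]
    exact mul_mem_bidegree ha hb
  · refine fun c => bidegree_induction (fun a ha b hb => ?_) (fun _ _ => Submodule.add_mem _)
    rw [inclA_mul_inclB]
    exact ⟨_, Submodule.apply_mem_map₂ _ ha hb, rfl⟩

theorem bidegree_le_grading {s i n : ℤ} (h : s + i = n) : bidegree τ s i ≤ grading τ n := by
  rw [grading_eq_iSup]
  obtain rfl : i = n - s := by omega
  exact le_iSup (fun s => bidegree τ s (n - s)) s

end TwistedTensor

open TwistedTensor

/-- The twisting map sends `B_i ⊗ A_s` to `A_s ⊗ B_i`. -/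
def TwistingMap.PreservesBidegree : Prop :=
  ∀ i s, ∀ b ∈ ℬ i, ∀ a ∈ 𝒜 s, inclB τ b * inclA τ a ∈ bidegree τ s i

/-- Moving a product b b' past a is moving b' first and then b, by associativity in C, so the
property is multiplicative in b and need only be checked on generators, where it is visible from the
formula for τ. -/
theorem TwistingMap.preservesBidegree_of_generators [GradedAlgebra 𝒜] [GradedAlgebra ℬ]
    {m : ℕ} {y : Fin m → B}
    (hy : Algebra.adjoin k (Set.range y) = ⊤) {l : ℤ} (hl : ∀ i, y i ∈ ℬ l)
    {σ : A → Matrix (Fin m) (Fin m) A} (hσ : ∀ d, ∀ a ∈ 𝒜 d, ∀ i j, σ a i j ∈ 𝒜 d)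
    (hτ : ∀ i a, τ.toLin (y i ⊗ₜ[k] a) = ∑ t, σ a i t ⊗ₜ[k] y t) : τ.PreservesBidegree := by
  -- `G i` collects the elements that behave under commutation like elements of degree i; membership
  -- in `ℬ i` is not demanded.
  let G (i : ℤ) : Submodule k B :=
    { carrier := {b | ∀ s, ∀ a ∈ 𝒜 s, inclB τ b * inclA τ a ∈ bidegree τ s i}
      add_mem' := fun {b b'} hb hb' s a ha => by
        rw [map_add, add_mul]
        exact Submodule.add_mem _ (hb s a ha) (hb' s a ha)
      zero_mem' := fun s a _ => by simp
      smul_mem' := fun c b hb s a ha => by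
        rw [map_smul, smul_mul_assoc]
        exact Submodule.smul_mem _ _ (hb s a ha) }
  have hG (i j : ℤ) {b b' : B} (hb : b ∈ G i) (hb' : b' ∈ G j) : b * b' ∈ G (i + j) := by
    intro s a ha
    rw [map_mul, mul_assoc]
    refine bidegree_induction (p := fun c => inclB τ b * c ∈ bidegree τ s (i + j)) ?_ ?_
      (hb' s a ha)
    · intro a' ha' b' hb'
      rw [← mul_assoc]
      refine bidegree_induction (p := fun c => c * inclB τ b' ∈ bidegree τ s (i + j)) ?_ ?_
        (hb s a' ha')
      · intro a'' ha'' b'' hb''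
        rw [mul_assoc, ← map_mul]
        exact mul_mem_bidegree ha'' (SetLike.GradedMul.mul_mem hb'' hb')
      · intro x y hx hy
        rw [add_mul]
        exact Submodule.add_mem _ hx hy
    · intro x y hx hy
      rw [mul_add]
      exact Submodule.add_mem _ hx hy
  have hyG (i : Fin m) : y i ∈ G l := by
    intro s a ha
    rw [inclB_mul_inclA, hτ, map_sum]
    refine Submodule.sum_mem _ fun t _ => ?_
    rw [← inclA_mul_inclB]
    exact mul_mem_bidegree (hσ s a ha i t) (hl t)
  have h1 : (1 : B) ∈ G 0 := by
    intro s a ha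
    rw [map_one, _root_.one_mul, ← _root_.mul_one (inclA τ a), ← map_one (inclB τ)]
    exact mul_mem_bidegree ha SetLike.GradedOne.one_mem
  classical
  -- Elements met in the induction over the generated algebra need not be homogeneous, so the claim
  -- is made for every homogeneous component.
  have key (b : B) : ∀ i, ((DirectSum.decompose ℬ b i : ℬ i) : B) ∈ G i := by
    have hb : b ∈ Algebra.adjoin k (Set.range y) := hy ▸ Algebra.mem_top
    have hom {b : B} {j : ℤ} (hb : b ∈ ℬ j) (hbG : b ∈ G j) (i : ℤ) :
        ((DirectSum.decompose ℬ b i : ℬ i) : B) ∈ G i := by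
      by_cases h : j = i
      · subst h
        rwa [DirectSum.decompose_of_mem_same ℬ hb]
      · rw [DirectSum.decompose_of_mem_ne ℬ hb h]
        exact Submodule.zero_mem _
    induction hb using Algebra.adjoin_induction with
    | mem b hb =>
      obtain ⟨i, rfl⟩ := hb
      exact hom (hl i) (hyG i)
    | algebraMap c =>
      rw [Algebra.algebraMap_eq_smul_one]
      exact hom (Submodule.smul_mem _ c SetLike.GradedOne.one_mem) (Submodule.smul_mem _ c h1)
    | add b b' _ _ hb hb' =>
      intro i
      simpa using Submodule.add_mem _ (hb i) (hb' i)
    | mul b b' _ _ hb hb' =>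
      intro i
      rw [DirectSum.decompose_mul, DirectSum.coe_mul_apply]
      refine Submodule.sum_mem _ fun p hp => ?_
      rw [← (Finset.mem_filter.1 hp).2]
      exact hG _ _ (hb _) (hb' _)
  intro i s b hb a ha
  have := key b i
  rw [DirectSum.decompose_of_mem_same ℬ hb] at this
  exact this s a ha

namespace TwistedTensor

variable {τ}

/-- In a b a' b' only the inner product b a' has to be reordered, and that preserves both degrees.
-/
theorem mul_mem_bidegree_add [SetLike.GradedMonoid 𝒜] [SetLike.GradedMonoid ℬ]
    (hτ : τ.PreservesBidegree) {s i t j : ℤ}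
    {c c' : TwistedTensor τ} (hc : c ∈ bidegree τ s i) (hc' : c' ∈ bidegree τ t j) :
    c * c' ∈ bidegree τ (s + t) (i + j) := by
  refine bidegree_induction (p := fun c => c * c' ∈ _) ?_ ?_ hc
  · intro a ha b hb
    refine bidegree_induction (p := fun c' => inclA τ a * inclB τ b * c' ∈ _) ?_ ?_ hc'
    · intro a' ha' b' hb'
      rw [mul_assoc, ← mul_assoc (inclB τ b)]
      refine bidegree_induction (p := fun c => inclA τ a * (c * inclB τ b') ∈ _) ?_ ?_
        (hτ i t b hb a' ha')
      · intro a'' ha'' b'' hb''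
        rw [mul_assoc, ← mul_assoc (inclA τ a), ← map_mul, ← map_mul]
        exact mul_mem_bidegree (SetLike.GradedMul.mul_mem ha ha'')
          (SetLike.GradedMul.mul_mem hb'' hb')
      · intro x y hx hy
        rw [add_mul, mul_add]
        exact Submodule.add_mem _ hx hy
    · intro x y hx hy
      rw [mul_add]
      exact Submodule.add_mem _ hx hy
  · intro x y hx hy
    rw [add_mul]
    exact Submodule.add_mem _ hx hy

theorem mul_mem_grading [SetLike.GradedMonoid 𝒜] [SetLike.GradedMonoid ℬ]
    (hτ : τ.PreservesBidegree) {i j n : ℤ} (hn : i + j = n)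
    {c c' : TwistedTensor τ} (hc : c ∈ grading τ i) (hc' : c' ∈ grading τ j) :
    c * c' ∈ grading τ n := by
  rw [grading_eq_iSup] at hc hc'
  induction hc using Submodule.iSup_induction' with
  | mem s c hc =>
    induction hc' using Submodule.iSup_induction' with
    | mem t c' hc' =>
      exact bidegree_le_grading τ (by omega) (mul_mem_bidegree_add hτ hc hc')
    | zero => simp
    | add x y _ _ hx hy => rw [mul_add]; exact Submodule.add_mem _ hx hy
  | zero => simp
  | add x y _ _ hx hy => rw [add_mul]; exact Submodule.add_mem _ hx hy

theorem inclA_mem_grading [SetLike.GradedMonoid ℬ] {n : ℤ} {a : A} (ha : a ∈ 𝒜 n) :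
    inclA τ a ∈ grading τ n := by
  rw [← mul_one (inclA τ a), ← map_one (inclB τ)]
  exact bidegree_le_grading τ (add_zero n) (mul_mem_bidegree ha SetLike.GradedOne.one_mem)

theorem inclB_mem_grading [SetLike.GradedMonoid 𝒜] {n : ℤ} {b : B} (hb : b ∈ ℬ n) :
    inclB τ b ∈ grading τ n := by
  rw [← one_mul (inclB τ b), ← map_one (inclA τ)]
  exact bidegree_le_grading τ (zero_add n) (mul_mem_bidegree SetLike.GradedOne.one_mem hb)

/-! ### The projection of A ⊗^τ B onto A -/

section Projection

variable [GradedAlgebra ℬ] [IsConnectedGraded ℬ]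

variable (τ) in
/-- The map `id_A ⊗ ε_B : A ⊗^τ B → A`. -/
def projA : TwistedTensor τ →ₗ[k] A :=
  (TensorProduct.rid k A).toLinearMap ∘ₗ LinearMap.lTensor A (augmentation ℬ).toLinearMap ∘ₗ
    (of τ).symm.toLinearMap

theorem projA_mul_inclB (a : A) (b : B) :
    projA τ (inclA τ a * inclB τ b) = augmentation ℬ b • a := by
  rw [inclA_mul_inclB]
  simp [projA]

theorem projA_inclA_mul (a : A) (c : TwistedTensor τ) :
    projA τ (inclA τ a * c) = a * projA τ c := by
  induction c using TwistedTensor.induction_on with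
  | add c c' hc hc' => simp only [mul_add, map_add, hc, hc']
  | mul a' b => rw [← mul_assoc, ← map_mul, projA_mul_inclB, projA_mul_inclB, mul_smul_comm]

/-- For b of nonzero degree i, the product b a stays in A ⊗ B_i, which ε_B kills. A twisting map
that is merely graded could produce a component in A ⊗ B_0 and break right linearity. -/
theorem projA_mul_inclA [GradedAlgebra 𝒜] (hτ : τ.PreservesBidegree) (c : TwistedTensor τ) (a : A) :
    projA τ (c * inclA τ a) = projA τ c * a := by
  induction c using TwistedTensor.induction_on with
  | add c c' hc hc' => simp only [add_mul, map_add, hc, hc']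
  | mul a' b =>
    rw [mul_assoc, projA_inclA_mul, projA_mul_inclB, smul_mul_assoc, ← mul_smul_comm]
    congr 1
    induction b using DirectSum.Decomposition.inductionOn ℬ with
    | zero => simp
    | add b b' h h' => simp only [map_add, add_mul, add_smul, h, h']
    | @homogeneous i b =>
      by_cases hi : i = 0
      · subst hi
        obtain ⟨c, hc⟩ := exists_algebraMap ℬ b.2
        rw [hc, augmentation_algebraMap, AlgHom.commutes, ← Algebra.smul_def, map_smul]
        rw [← mul_one (inclA τ a), ← map_one (inclB τ), projA_mul_inclB, map_one, one_smul]
      · rw [augmentation_of_ne ℬ hi b.2, zero_smul]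
        induction a using DirectSum.Decomposition.inductionOn 𝒜 with
        | zero => simp
        | add a a' h h' => simp only [map_add, mul_add, h, h', add_zero]
        | @homogeneous s a =>
          refine bidegree_induction (p := fun c => projA τ c = 0) ?_ ?_
            (hτ i s b b.2 a a.2)
          · intro a _ b hb
            rw [projA_mul_inclB, augmentation_of_ne ℬ hi hb, zero_smul]
          · intro x y hx hy
            rw [map_add, hx, hy, add_zero]

end Projection

/-! ### The augmentation of A ⊗^τ B and its kernel -/

section Augmentation

variable [GradedAlgebra 𝒜] [IsConnectedGraded 𝒜] [GradedAlgebra ℬ] [IsConnectedGraded ℬ]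

theorem aug_inclA (a : A) : aug τ (inclA τ a) = augmentation 𝒜 a := by
  rw [inclA_apply, aug_of, map_one, mul_one]

theorem aug_inclB (b : B) : aug τ (inclB τ b) = augmentation ℬ b := by
  rw [inclB_apply, aug_of, map_one, one_mul]

theorem aug_of_ne {n : ℤ} (hn : n ≠ 0) {c : TwistedTensor τ} (hc : c ∈ grading τ n) :
    aug τ c = 0 := by
  obtain ⟨c, hc, rfl⟩ := hc
  exact tensorAugmentation_of_ne 𝒜 ℬ hn hc

/-- This is C = k ⊕ C_{≥1}: among the bidegrees only (0, 0) is not of positive total degree, and its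
elements are scalars, which cancel. -/
theorem sub_aug_smul_mem_positivePart {M : Type u} [AddCommGroup M] [Module (TwistedTensor τ) M]
    (c : TwistedTensor τ) (x : M) :
    (c - algebraMap k _ (aug τ c)) • x ∈ positivePart (grading τ) M := by
  induction c using TwistedTensor.induction_on with
  | add c c' hc hc' =>
    rw [map_add, map_add, add_sub_add_comm, add_smul]
    exact Submodule.add_mem _ hc hc'
  | mul a b =>
    induction a using DirectSum.Decomposition.inductionOn 𝒜 with
    | zero => simp
    | add a a' h h' =>
      rw [map_add, add_mul, map_add, map_add, add_sub_add_comm, add_smul]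
      exact Submodule.add_mem _ h h'
    | @homogeneous i a =>
      induction b using DirectSum.Decomposition.inductionOn ℬ with
      | zero => simp
      | add b b' h h' =>
        rw [map_add, mul_add, map_add, map_add, add_sub_add_comm, add_smul]
        exact Submodule.add_mem _ h h'
      | @homogeneous j b =>
        rcases lt_or_ge i 0 with hi | hi
        · simp [eq_zero_of_neg 𝒜 hi a.2]
        rcases lt_or_ge j 0 with hj | hj
        · simp [eq_zero_of_neg ℬ hj b.2]
        by_cases h : i + j = 0
        · obtain rfl : i = 0 := by omega
          obtain rfl : j = 0 := by omega
          obtain ⟨c, hc⟩ := exists_algebraMap 𝒜 a.2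
          obtain ⟨c', hc'⟩ := exists_algebraMap ℬ b.2
          rw [hc, hc', AlgHom.commutes, AlgHom.commutes, ← map_mul, AlgHom.commutes]
          simp
        · have hm : inclA τ a * inclB τ b ∈ grading τ (i + j) :=
            bidegree_le_grading τ rfl (mul_mem_bidegree a.2 b.2)
          rw [aug_of_ne h hm, map_zero, sub_zero]
          exact Submodule.subset_span ⟨i + j, by omega, _, hm, x, rfl⟩

theorem smul_mem_positivePart {M : Type u} [AddCommGroup M] [Module (TwistedTensor τ) M]
    {c : TwistedTensor τ} (hc : aug τ c = 0) (x : M) :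
    c • x ∈ positivePart (grading τ) M := by
  simpa [hc] using sub_aug_smul_mem_positivePart c x

theorem augmentation_projA (c : TwistedTensor τ) :
    augmentation 𝒜 (projA τ c) = aug τ c := by
  induction c using TwistedTensor.induction_on with
  | add c c' hc hc' => simp only [map_add, hc, hc']
  | mul a b => rw [projA_mul_inclB, map_smul, map_mul, aug_inclA, aug_inclB, smul_eq_mul, mul_comm]

end Augmentation

end TwistedTensor

end Twisted

/-! ## Induced maps in coordinates -/

theorem linearMap_pi_apply {R : Type u} [Ring R] {r s : ℕ} (f : (Fin r → R) →ₗ[R] (Fin s → R))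
    (x : Fin r → R) (j : Fin s) : f x j = ∑ i, x i * f (Pi.single i 1) j := by
  conv_lhs => rw [pi_eq_sum_univ' x, map_sum, Finset.sum_apply]
  exact Finset.sum_congr rfl fun i _ => by rw [map_smul, Pi.smul_apply, smul_eq_mul]

section Induced

variable {k : Type u} [Field k] {A B : Type u} [Ring A] [Algebra k A] [Ring B] [Algebra k B]
variable {𝒜 : ℤ → Submodule k A} {ℬ : ℤ → Submodule k B} (τ : TwistingMap 𝒜 ℬ)

open TwistedTensor

theorem inducedEquiv_smul {r : ℕ} (a : A) (x : A ⊗[k] (Fin r → B)) :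
    inducedEquiv τ r (a • x) = inclA τ a • inducedEquiv τ r x := by
  induction x with
  | zero => simp
  | add x y hx hy => rw [smul_add, map_add, map_add, smul_add, hx, hy]
  | tmul a' q =>
    ext i
    rw [smul_tmul', Pi.smul_apply, inducedEquiv_tmul, inducedEquiv_tmul, smul_eq_mul, smul_eq_mul,
      ← inclA_mul_inclB, ← inclA_mul_inclB, map_mul, mul_assoc]

theorem inducedEquiv_symm_apply {r : ℕ} (x : Fin r → TwistedTensor τ) :
    (inducedEquiv τ r).symm x =
      ∑ i, LinearMap.lTensor A (LinearMap.single k (fun _ => B) i) ((of τ).symm (x i)) := by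
  rw [LinearEquiv.symm_apply_eq, map_sum]
  ext j
  rw [Finset.sum_apply, Finset.sum_eq_single j]
  · generalize hc : (of τ).symm (x j) = c
    rw [LinearEquiv.symm_apply_eq] at hc
    rw [hc]
    clear hc
    induction c with
    | zero => simp
    | add x y hx hy => simp only [map_add, Pi.add_apply, ← hx, ← hy]
    | tmul a b => rw [LinearMap.lTensor_tmul, inducedEquiv_tmul]; simp
  · intro i _ hij
    generalize (of τ).symm (x i) = c
    induction c with
    | zero => simp
    | add x y hx hy => simp only [map_add, Pi.add_apply, hx, hy, add_zero]
    | tmul a b =>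
      rw [LinearMap.lTensor_tmul, inducedEquiv_tmul, LinearMap.single_apply,
        Pi.single_eq_of_ne hij.symm, tmul_zero, map_zero]
  · simp

theorem inducedEquiv_one_tmul_single {r : ℕ} (i : Fin r) :
    inducedEquiv τ r (1 ⊗ₜ Pi.single i 1) = Pi.single i 1 := by
  ext j
  rw [inducedEquiv_tmul]
  by_cases h : j = i
  · subst h
    rw [Pi.single_eq_same, Pi.single_eq_same, one_def]
  · rw [Pi.single_eq_of_ne h, Pi.single_eq_of_ne h, tmul_zero, map_zero]

theorem inducedMap_single {r s : ℕ} (f : (Fin r → B) →ₗ[B] (Fin s → B)) (i : Fin r) :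
    inducedMap τ f (Pi.single i 1) = inducedEquiv τ s (1 ⊗ₜ f (Pi.single i 1)) := by
  rw [← inducedEquiv_one_tmul_single, inducedMap_inducedEquiv, LinearMap.lTensor_tmul]
  rfl

theorem inducedMap_apply {r s : ℕ} (f : (Fin r → B) →ₗ[B] (Fin s → B))
    (x : Fin r → TwistedTensor τ) (j : Fin s) :
    inducedMap τ f x j = ∑ i, x i * inclB τ (f (Pi.single i 1) j) := by
  rw [linearMap_pi_apply]
  exact Finset.sum_congr rfl fun i _ => by rw [inducedMap_single, inducedEquiv_tmul, inclB_apply]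

theorem twistedRight_apply {r : ℕ} (φ : A →ₐ[k] Matrix (Fin r) (Fin r) A) (a : A)
    (x : Fin r → TwistedTensor τ) (j : Fin r) :
    twistedRight τ φ (MulOpposite.op a) x j = ∑ i, x i * inclA τ (φ a i j) := rfl

theorem twistedRight_smul {r : ℕ} (φ : A →ₐ[k] Matrix (Fin r) (Fin r) A) (c : k) (a : A)
    (x : Fin r → TwistedTensor τ) :
    twistedRight τ φ (MulOpposite.op (c • a)) x = c • twistedRight τ φ (MulOpposite.op a) x := by
  ext j
  rw [Pi.smul_apply, twistedRight_apply, twistedRight_apply, Finset.smul_sum]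
  exact Finset.sum_congr rfl fun i _ => by
    rw [map_smul, Matrix.smul_apply, map_smul, mul_smul_comm]

/-- On underlying vector spaces these maps are id_A ⊗ f and id_A ⊗ g, and A is flat over the field
k. -/
theorem exact_inducedMap {r s t : ℕ} {f : (Fin r → B) →ₗ[B] (Fin s → B)}
    {g : (Fin s → B) →ₗ[B] (Fin t → B)} (h : Function.Exact f g) :
    Function.Exact (inducedMap τ f) (inducedMap τ g) := by
  intro x
  obtain ⟨x, rfl⟩ := (inducedEquiv τ s).surjective x
  have h' : Function.Exact (LinearMap.lTensor A (f.restrictScalars k))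
      (LinearMap.lTensor A (g.restrictScalars k)) := Module.Flat.lTensor_exact A h
  rw [inducedMap_inducedEquiv, LinearEquiv.map_eq_zero_iff, h' x]
  constructor
  · rintro ⟨y, rfl⟩
    exact ⟨inducedEquiv τ r y, inducedMap_inducedEquiv τ f y⟩
  · rintro ⟨y, hy⟩
    obtain ⟨y, rfl⟩ := (inducedEquiv τ r).surjective y
    rw [inducedMap_inducedEquiv] at hy
    exact ⟨y, (inducedEquiv τ s).injective hy⟩

variable {τ}

/-- If the coordinates of a `B`-linear map between free modules are homogeneous of degree `u`,
it is exact on degree zero scalars in the source and degree `u` vectors in the target. -/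
theorem exists_map_algebraMap_eq [GradedAlgebra ℬ] [IsConnectedGraded ℬ] {r s : ℕ}
    (f : (Fin r → B) →ₗ[B] (Fin s → B)) {u : ℤ} (hu : ∀ i j, f (Pi.single i 1) j ∈ ℬ u)
    {v : Fin r → B} (hv : ∀ j, f v j ∈ ℬ u) :
    f (fun i => algebraMap k B (augmentation ℬ (v i))) = f v := by
  ext j
  -- Take degree u components in f(v)_j = ∑ v_i f(e_i)_j. As f(e_i)_j has degree u, only the degree
  -- zero part of v_i, the scalar ε_B(v_i), contributes.
  have h := DirectSum.decompose_of_mem_same ℬ (hv j)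
  rw [← h, linearMap_pi_apply, linearMap_pi_apply, DirectSum.decompose_sum, DFinsupp.finsetSum_apply,
    AddSubmonoidClass.coe_finsetSum]
  refine Finset.sum_congr rfl fun i _ => ?_
  have h' := DirectSum.coe_decompose_mul_add_of_right_mem ℬ (i := 0) (a := v i) (hu i j)
  rw [zero_add] at h'
  rw [h', decompose_zero_eq]

/-- The action of right multiplication by `φ` on a vector of elements of `B_u` stays in
`A ⊗ B_u`. -/
theorem twistedRight_mem_bidegree (hτ : τ.PreservesBidegree) {r : ℕ}
    {φ : A →ₐ[k] Matrix (Fin r) (Fin r) A} (hφ : ∀ n, ∀ a ∈ 𝒜 n, ∀ i j, φ a i j ∈ 𝒜 n)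
    {u n : ℤ} {q : Fin r → B} (hq : ∀ i, q i ∈ ℬ u) {a : A} (ha : a ∈ 𝒜 n) (j : Fin r) :
    twistedRight τ φ (MulOpposite.op a) (inducedEquiv τ r (1 ⊗ₜ q)) j ∈ bidegree τ n u := by
  rw [twistedRight_apply]
  refine Submodule.sum_mem _ fun i _ => ?_
  rw [inducedEquiv_tmul]
  exact hτ u n _ (hq i) _ (hφ n a ha i j)

/-- A vector with coordinates in `A ⊗ B_u` comes from `A ⊗ (B_u)^r`. -/
theorem inducedEquiv_symm_mem_range {r : ℕ} {n u : ℤ} {x : Fin r → TwistedTensor τ}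
    (hx : ∀ i, x i ∈ bidegree τ n u) :
    (inducedEquiv τ r).symm x ∈
      LinearMap.range (LinearMap.lTensor A (Submodule.pi Set.univ fun _ : Fin r => ℬ u).subtype) := by
  classical
  rw [inducedEquiv_symm_apply]
  refine Submodule.sum_mem _ fun i _ => ?_
  refine bidegree_induction (p := fun c => LinearMap.lTensor A (LinearMap.single k (fun _ => B) i)
    ((of τ).symm c) ∈ LinearMap.range _) ?_ ?_ (hx i)
  · intro a _ b hb
    refine ⟨a ⊗ₜ ⟨Pi.single i b, fun j _ => ?_⟩, ?_⟩
    · by_cases h : j = i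
      · subst h
        simpa using hb
      · simp [Pi.single_eq_of_ne h]
    · rw [inclA_mul_inclB]
      simp
  · intro x y hx hy
    rw [map_add, map_add]
    exact Submodule.add_mem _ hx hy

/-- A functional on the B side leaves the A factor of A_n ⊗ B_u untouched. This will show that the
homomorphism built in `exists_twist` preserves degrees. -/
theorem rid_lTensor_symm_mem {r : ℕ} {n u : ℤ} {x : Fin r → TwistedTensor τ}
    (hx : ∀ i, x i ∈ bidegree τ n u) (l : (Fin r → B) →ₗ[k] k) :
    TensorProduct.rid k A (LinearMap.lTensor A l ((inducedEquiv τ r).symm x)) ∈ 𝒜 n := by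
  rw [inducedEquiv_symm_apply, map_sum, map_sum]
  refine Submodule.sum_mem _ fun i _ => ?_
  refine bidegree_induction (p := fun c => TensorProduct.rid k A (LinearMap.lTensor A l
    (LinearMap.lTensor A (LinearMap.single k (fun _ => B) i) ((of τ).symm c))) ∈ 𝒜 n) ?_ ?_ (hx i)
  · intro a ha b _
    rw [inclA_mul_inclB]
    simpa using Submodule.smul_mem _ _ ha
  · intro x y hx hy
    simp only [map_add]
    exact Submodule.add_mem _ hx hy

/-- A linear map `f` with homogeneous coordinates, exact before `g` and injective on scalars, lifts
a right action of `A` preserving the kernel of `id_A ⊗ g` along `id_A ⊗ f`. -/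
theorem exists_twist [GradedAlgebra 𝒜] [GradedAlgebra ℬ] [IsConnectedGraded ℬ]
    (hτ : τ.PreservesBidegree) {r s t : ℕ}
    (f : (Fin r → B) →ₗ[B] (Fin s → B)) (g : (Fin s → B) →ₗ[B] (Fin t → B))
    (hfg : Function.Exact f g) {u : ℤ} (hu : ∀ i j, f (Pi.single i 1) j ∈ ℬ u)
    (hf : ∀ w : Fin r → k, f (fun i => algebraMap k B (w i)) = 0 → w = 0)
    (φ : A →ₐ[k] Matrix (Fin s) (Fin s) A) (hφ : ∀ n, ∀ a ∈ 𝒜 n, ∀ i j, φ a i j ∈ 𝒜 n)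
    (hg : ∀ a x, inducedMap τ g x = 0 → inducedMap τ g (twistedRight τ φ a x) = 0) :
    ∃ ψ : A →ₐ[k] Matrix (Fin r) (Fin r) A, (∀ n, ∀ a ∈ 𝒜 n, ∀ i j, ψ a i j ∈ 𝒜 n) ∧
      ∀ a x, inducedMap τ f (twistedRight τ ψ a x) = twistedRight τ φ a (inducedMap τ f x) := by
  -- The restriction of f to scalar vectors. It is injective by `hf`, so over a field it has a
  -- linear retraction p, which will read off coefficients.
  let ι : (Fin r → k) →ₗ[k] (Fin s → B) :=
    f.restrictScalars k ∘ₗ (Algebra.linearMap k B).compLeft (Fin r)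
  have hι (w : Fin r → k) : ι w = f (fun i => algebraMap k B (w i)) := rfl
  obtain ⟨p, hp⟩ := ι.exists_leftInverse_of_injective
    (LinearMap.ker_eq_bot'.2 fun w hw => hf w hw)
  let q (i : Fin r) : Fin s → B := f (Pi.single i 1)
  have hιq (w : Fin r → k) : ι w = ∑ j, w j • q j := by
    rw [pi_eq_sum_univ' w, map_sum]
    refine Finset.sum_congr rfl fun j _ => ?_
    rw [map_smul, hι, ← pi_eq_sum_univ']
    congr 2
    ext i
    by_cases h : i = j
    · subst h; simp
    · simp [Pi.single_eq_of_ne h]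
  have hpq (i : Fin r) : p (q i) = Pi.single i 1 := by
    have h : q i = ι (Pi.single i 1) := by simp [hιq, Pi.single_apply]
    rw [h]
    exact LinearMap.congr_fun hp _
  let E (i : Fin r) : Fin s → TwistedTensor τ := inducedMap τ f (Pi.single i 1)
  have hE (i : Fin r) : E i = inducedEquiv τ s (1 ⊗ₜ q i) := inducedMap_single τ f i
  have hgE (i : Fin r) : inducedMap τ g (E i) = 0 := (exact_inducedMap τ hfg _).2 ⟨_, rfl⟩
  let X (i : Fin r) (a : A) : Fin s → TwistedTensor τ := twistedRight τ φ (MulOpposite.op a) (E i)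
  have hX {n : ℤ} {a : A} (ha : a ∈ 𝒜 n) (i : Fin r) (j : Fin s) : X i a j ∈ bidegree τ n u := by
    simp only [X, hE]
    exact twistedRight_mem_bidegree hτ hφ (hu i) ha j
  have hXadd (i : Fin r) (a b : A) : X i (a + b) = X i a + X i b := by
    simp only [X, MulOpposite.op_add, map_add, LinearMap.add_apply]
  have hXsmul (i : Fin r) (c : k) (a : A) : X i (c • a) = c • X i a := twistedRight_smul τ φ c a _
  -- The strand of the complex in which the middle term has coordinates in B_u: k^r → (B_u)^s → B^t
  -- is exact in the middle.
  have hι' : Function.Exact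
      (ι.codRestrict (Submodule.pi Set.univ fun _ : Fin s => ℬ u) (fun w => by
        rw [hιq]
        exact Submodule.sum_mem _ fun j _ => Submodule.smul_mem _ _ fun i _ => hu j i))
      (g.restrictScalars k ∘ₗ (Submodule.pi Set.univ fun _ : Fin s => ℬ u).subtype) := by
    rintro ⟨x, hx⟩
    constructor
    · intro h
      obtain ⟨v, rfl⟩ := (hfg x).1 h
      exact ⟨fun i => augmentation ℬ (v i),
        Subtype.ext (exists_map_algebraMap_eq f hu fun j => hx j trivial)⟩
    · rintro ⟨w, hw⟩
      exact (hfg x).2 ⟨_, congrArg Subtype.val hw⟩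
  -- X i a is a cycle with coordinates in A ⊗ B_u; tensoring the exact strand with A places it in A
  -- ⊗ ι(k^r), the left A-span of the E_j.
  have key (i : Fin r) (a : A) :
      (inducedEquiv τ s).symm (X i a) ∈ LinearMap.range (LinearMap.lTensor A ι) := by
    induction a using DirectSum.Decomposition.inductionOn 𝒜 with
    | zero => simp [X]
    | add a b ha hb => rw [hXadd, map_add]; exact Submodule.add_mem _ ha hb
    | @homogeneous n a =>
      obtain ⟨z, hz⟩ := inducedEquiv_symm_mem_range (hX a.2 i)
      have h0 : LinearMap.lTensor A (g.restrictScalars k) ((inducedEquiv τ s).symm (X i a)) = 0 := by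
        have h := hg (MulOpposite.op (a : A)) (E i) (hgE i)
        rw [← (inducedEquiv τ s).apply_symm_apply (twistedRight τ φ _ _),
          inducedMap_inducedEquiv] at h
        exact (LinearEquiv.map_eq_zero_iff _).1 h
      rw [← hz, ← LinearMap.comp_apply, ← LinearMap.lTensor_comp] at h0
      obtain ⟨w, rfl⟩ := (Module.Flat.lTensor_exact A hι' z).1 h0
      refine ⟨w, ?_⟩
      rw [← hz, ← LinearMap.comp_apply, ← LinearMap.lTensor_comp]
      rfl
  -- The functional id_A ⊗ (j-th coordinate of p), which extracts the coefficient of E_j.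
  let θ (j : Fin r) : (Fin s → TwistedTensor τ) →ₗ[k] A :=
    (TensorProduct.rid k A).toLinearMap ∘ₗ LinearMap.lTensor A (LinearMap.proj j ∘ₗ p) ∘ₗ
      (inducedEquiv τ s).symm.toLinearMap.restrictScalars k
  have hEsmul (c : A) (i : Fin r) : inclA τ c • E i = inducedEquiv τ s (c ⊗ₜ q i) := by
    rw [hE, ← inducedEquiv_smul, smul_tmul', smul_eq_mul, mul_one]
  -- Coefficients with respect to the E_j are unique. Both the unit and the product law for ψ follow
  -- by comparing two expansions.
  have hθ (c : Fin r → A) (j : Fin r) : θ j (∑ i, inclA τ (c i) • E i) = c j := by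
    simp only [θ, hEsmul, map_sum]
    simp [hpq, Pi.single_apply]
  have expand (i : Fin r) (a : A) : X i a = ∑ j, inclA τ (θ j (X i a)) • E j := by
    obtain ⟨z, hz⟩ := key i a
    rw [LinearEquiv.eq_symm_apply] at hz
    rw [← hz]
    clear hz
    induction z with
    | zero => simp
    | add x y hx hy =>
      simp only [map_add, add_smul, Finset.sum_add_distrib]
      rw [← hx, ← hy]
    | tmul a w =>
      simp only [hEsmul]
      rw [← map_sum]
      congr 1
      rw [LinearMap.lTensor_tmul, hιq, tmul_sum]
      refine Finset.sum_congr rfl fun j _ => ?_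
      have h : θ j (inducedEquiv τ s (a ⊗ₜ[k] ∑ j, w j • q j)) = w j • a := by
        simp [θ, hpq, Pi.single_apply]
      rw [← tmul_sum, h, smul_tmul]
  let ψ : A →ₐ[k] Matrix (Fin r) (Fin r) A := AlgHom.ofLinearMap
    { toFun := fun a => Matrix.of fun i j => θ j (X i a)
      map_add' := fun a b => by ext i j; simp [hXadd]
      map_smul' := fun c a => by ext i j; simp [hXsmul] }
    (by
      ext i j
      have h : X i 1 = ∑ t, inclA τ ((1 : Matrix (Fin r) (Fin r) A) i t) • E t := by
        simp [X, Matrix.one_apply]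
      change θ j (X i 1) = _
      rw [h, hθ])
    (fun a b => by
      ext i j
      -- Expand E_i * (a b) = (E_i * a) * b in two stages; left multiplication by A commutes with
      -- the right action.
      have h : X i (a * b) = ∑ t, inclA τ (∑ v, θ v (X i a) * θ t (X v b)) • E t := by
        have h1 : X i (a * b) = twistedRight τ φ (MulOpposite.op b) (X i a) := by
          simp only [X, MulOpposite.op_mul, map_mul]
          rfl
        have h2 (v : Fin r) : twistedRight τ φ (MulOpposite.op b) (inclA τ (θ v (X i a)) • E v) =
            ∑ t, inclA τ (θ v (X i a) * θ t (X v b)) • E t := by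
          rw [map_smul]
          change _ • X v b = _
          rw [expand v b, Finset.smul_sum]
          refine Finset.sum_congr rfl fun t _ => ?_
          rw [smul_smul, ← map_mul, hθ]
        rw [h1, expand i a, map_sum]
        simp only [h2]
        rw [Finset.sum_comm]
        refine Finset.sum_congr rfl fun t _ => ?_
        simp only [map_sum, Finset.sum_smul, hθ]
      change θ j (X i (a * b)) = ∑ v, θ v (X i a) * θ j (X v b)
      rw [h, hθ])
  refine ⟨ψ, fun n a ha i j => rid_lTensor_symm_mem (hX ha i) _, fun a x => ?_⟩
  -- Both sides are C-linear in x, so compare on basis vectors, where the identity is the expansion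
  -- defining ψ.
  refine LinearMap.congr_fun (f := inducedMap τ f ∘ₗ twistedRight τ ψ a)
    (g := twistedRight τ φ a ∘ₗ inducedMap τ f) ((Pi.basisFun _ _).ext fun i => ?_) x
  rw [Pi.basisFun_apply, LinearMap.comp_apply, LinearMap.comp_apply]
  have h : twistedRight τ ψ a (Pi.single i 1) =
      ∑ j, inclA τ (θ j (X i a.unop)) • Pi.single j 1 := by
    ext t
    rw [← MulOpposite.op_unop a, twistedRight_apply]
    simp [Pi.single_apply, Finset.sum_apply]
    rfl
  rw [h, map_sum]
  simp only [map_smul]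
  exact (expand i a.unop).symm

end Induced

/-! ## Minimal resolutions in coordinates -/

section Free

variable {k : Type u} [Field k] {A : Type u} [Ring A] [Algebra k A]

theorem single_mem_freeGrading {𝒜 : ℤ → Submodule k A} [SetLike.GradedMonoid 𝒜]
    {r : ℕ} (deg : Fin r → ℤ) (i : Fin r) :
    Pi.single i 1 ∈ freeGrading 𝒜 deg (deg i) := by
  intro j _
  change (Pi.single i 1 : Fin r → A) j ∈ 𝒜 (deg i - deg j)
  by_cases h : j = i
  · subst h
    rw [Pi.single_eq_same, sub_self]
    exact SetLike.GradedOne.one_mem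
  · rw [Pi.single_eq_of_ne h]
    exact Submodule.zero_mem _

end Free

section Minimal

variable {k : Type u} [Field k] {A : Type u} [Ring A] [Algebra k A]
variable {𝒜 : ℤ → Submodule k A} [GradedAlgebra 𝒜] [IsConnectedGraded 𝒜] {P : FreeComplex 𝒜}

namespace FreeComplex

theorem complex_d (P : FreeComplex 𝒜) (n : ℕ) :
    P.complex.d (n + 1) n = ModuleCat.ofHom (P.d n) :=
  ChainComplex.of_d (fun n => ModuleCat.of A (Fin (P.rank n) → A))
    (fun n => ModuleCat.ofHom (P.d n)) n

namespace IsMinimalResolution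

theorem exact_d (hP : P.IsMinimalResolution) (n : ℕ) : Function.Exact (P.d (n + 1)) (P.d n) := by
  have h := ((quasiIso_single₀_iff _).1 hP.quasiIso).1 n
  rw [P.complex_d, P.complex_d] at h
  exact h

theorem exact_aug (hP : P.IsMinimalResolution) : Function.Exact (P.d 0) P.aug₀ := by
  have h := ((quasiIso_single₀_iff _).1 hP.quasiIso).2.1
  rw [P.complex_d] at h
  exact h

theorem d_single_mem (hP : P.IsMinimalResolution) (n : ℕ) (i : Fin (P.rank (n + 1)))
    (j : Fin (P.rank n)) : P.d n (Pi.single i 1) j ∈ 𝒜 (P.deg (n + 1) i - P.deg n j) := by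
  have h := hP.d_graded n (P.deg (n + 1) i) (Pi.single i 1) (single_mem_freeGrading _ i)
  rw [P.complex_d] at h
  exact h j trivial

theorem augmentation_d (hP : P.IsMinimalResolution) (n : ℕ) (x : Fin (P.rank (n + 1)) → A)
    (j : Fin (P.rank n)) : augmentation 𝒜 (P.d n x j) = 0 := by
  have h := hP.minimal n
  rw [P.complex_d] at h
  exact augmentation_eq_zero_of_mem_positivePart 𝒜 (h ⟨x, rfl⟩) j

/-- A scalar vector in the kernel is a boundary by exactness, and by minimality every boundary has
coordinates of augmentation zero. -/
theorem eq_zero_of_d_algebraMap (hP : P.IsMinimalResolution) (n : ℕ)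
    (w : Fin (P.rank (n + 1)) → k) (hw : P.d n (fun i => algebraMap k A (w i)) = 0) : w = 0 := by
  obtain ⟨v, hv⟩ := (hP.exact_d n _).1 hw
  ext i
  rw [← augmentation_algebraMap 𝒜 (w i), ← congrFun hv i, hP.augmentation_d, Pi.zero_apply]

end IsMinimalResolution

end FreeComplex

end Minimal

/-! ## Existence of the bimodule structures -/

section Existence

variable {k : Type u} [Field k] {A B : Type u} [Ring A] [Algebra k A] [Ring B] [Algebra k B]
variable {𝒜 : ℤ → Submodule k A} [GradedAlgebra 𝒜]
variable {ℬ : ℤ → Submodule k B} [GradedAlgebra ℬ] [IsConnectedGraded ℬ]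
variable {Q : FreeComplex ℬ} {τ : TwistingMap 𝒜 ℬ} {m : ℕ}

open TwistedTensor

/-- The y_i are the entries of the first differential of Q, so their degrees are those of the basis
of W₁, which purity makes equal. -/
theorem preservesBidegree_of_resolution (hQ : Q.IsMinimalResolution) (hpure : Q.IsPure)
    {y : Fin m → B} (hy : IsMinimalGeneratingSet ℬ y) (hm : Q.rank 1 = m)
    (hQy : ∀ j i, Q.d 0 (Pi.single j 1) i = y (Fin.cast hm j))
    {σ : A → Matrix (Fin m) (Fin m) A} (hσ : ∀ d, ∀ a ∈ 𝒜 d, ∀ i j, σ a i j ∈ 𝒜 d)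
    (hτ : ∀ i a, τ.toLin (y i ⊗ₜ[k] a) = ∑ t, σ a i t ⊗ₜ[k] y t) : τ.PreservesBidegree := by
  subst hm
  obtain ⟨l, hl⟩ := hpure 1
  refine τ.preservesBidegree_of_generators hy.2.1 (l := l) (fun i => ?_) hσ hτ
  have h := hQ.d_single_mem 0 i (Fin.cast Q.rank_zero.symm 0)
  rw [hQy, hl, Q.deg_zero, sub_zero] at h
  exact h

theorem nonempty_bimoduleTwist (hQ : Q.IsMinimalResolution) (hpure : Q.IsPure)
    {y : Fin m → B} (hm : Q.rank 1 = m)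
    (hQy : ∀ j i, Q.d 0 (Pi.single j 1) i = y (Fin.cast hm j)) (hbi : τ.PreservesBidegree)
    (σ : A →ₐ[k] Matrix (Fin m) (Fin m) A) (hσ : ∀ d, ∀ a ∈ 𝒜 d, ∀ i j, σ a i j ∈ 𝒜 d)
    (hτ : ∀ i a, τ.toLin (y i ⊗ₜ[k] a) = ∑ t, σ a i t ⊗ₜ[k] y t) :
    Nonempty (BimoduleTwist τ Q hm σ) := by
  subst hm
  choose l hl using hpure
  -- The index set of W₀ is only propositionally a singleton, so the identity of A appears as a ↦
  -- scalar matrix.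
  let φ₀ : A →ₐ[k] Matrix (Fin (Q.rank 0)) (Fin (Q.rank 0)) A :=
    (Matrix.diagonalAlgHom k).comp (Pi.constAlgHom k (Fin (Q.rank 0)) A)
  have hφ₀ (a : A) : φ₀ a = Matrix.diagonal fun _ => a := rfl
  have d₀ (a : Aᵐᵒᵖ) (x) : inducedMap τ (Q.d 0) (twistedRight τ σ a x) =
      twistedRight τ φ₀ a (inducedMap τ (Q.d 0) x) := by
    refine LinearMap.congr_fun (f := inducedMap τ (Q.d 0) ∘ₗ twistedRight τ σ a)
      (g := twistedRight τ φ₀ a ∘ₗ inducedMap τ (Q.d 0)) ((Pi.basisFun _ _).ext fun i => ?_) x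
    ext j
    rw [Pi.basisFun_apply, LinearMap.comp_apply, LinearMap.comp_apply, inducedMap_apply,
      ← MulOpposite.op_unop a, twistedRight_apply]
    simp only [inducedMap_apply, twistedRight_apply, hQy, hφ₀, Pi.single_apply, ite_mul, one_mul,
      zero_mul, Finset.sum_ite_eq', Finset.mem_univ, if_true, Matrix.diagonal_apply, apply_ite,
      map_zero, mul_zero, Fin.cast_eq_self]
    rw [inclB_mul_inclA, hτ, map_sum]
    exact Finset.sum_congr rfl fun t _ => inclA_mul_inclB τ _ _
  -- The recursion starts with σ on W₁, so index n refers to W_{n+1}. Carrying only stability of the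
  -- kernel of `Q.d n` lets each step use a single predecessor instead of two.
  let Good (n : ℕ) (φ : A →ₐ[k] Matrix (Fin (Q.rank (n + 1))) (Fin (Q.rank (n + 1))) A) : Prop :=
    (∀ d, ∀ a ∈ 𝒜 d, ∀ i j, φ a i j ∈ 𝒜 d) ∧ ∀ a x, inducedMap τ (Q.d n) x = 0 →
      inducedMap τ (Q.d n) (twistedRight τ φ a x) = 0
  have step (n : ℕ) (φ : {φ // Good n φ}) : ∃ ψ : {ψ // Good (n + 1) ψ}, ∀ a x,
      inducedMap τ (Q.d (n + 1)) (twistedRight τ ψ.1 a x) =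
        twistedRight τ φ.1 a (inducedMap τ (Q.d (n + 1)) x) := by
    obtain ⟨φ, hφ, hφ'⟩ := φ
    obtain ⟨ψ, hψ, hd⟩ := exists_twist hbi (Q.d (n + 1)) (Q.d n) (hQ.exact_d n)
      (u := l (n + 2) - l (n + 1))
      (fun i j => by
        have h := hQ.d_single_mem (n + 1) i j
        rwa [hl, hl] at h)
      (hQ.eq_zero_of_d_algebraMap (n + 1)) φ hφ hφ'
    exact ⟨⟨ψ, hψ, fun a x hx => by rw [hd, hx, map_zero]⟩, hd⟩
  choose next hnext using step
  let seq : ∀ n, {φ // Good n φ} := fun n =>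
    Nat.rec ⟨σ, hσ, fun a x hx => by rw [d₀, hx, map_zero]⟩ next n
  exact ⟨{
    φ := fun n => Nat.casesOn n φ₀ fun n => (seq n).1
    φ_graded := by
      rintro (_ | n)
      · intro d a ha i j
        change φ₀ a i j ∈ 𝒜 d
        rw [hφ₀, Matrix.diagonal_apply]
        split_ifs
        exacts [ha, Submodule.zero_mem _]
      · exact (seq n).2.1
    φ_zero := hφ₀
    φ_one := fun _ _ _ => rfl
    d_right := by
      rintro (_ | n)
      · exact d₀
      · exact hnext n (seq n) }⟩

end Existence

/-! ## Tensor products with free modules -/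

theorem balanced_mk_smul {k : Type u} [Field k] {A C : Type u} [Ring A] [Ring C] [Algebra k C]
    {M : Type u} [AddCommGroup M] [Module k M] [Module C M] [IsScalarTower k C M]
    (ρ : Aᵐᵒᵖ →+* Module.End C M) {N : Type u} [AddCommGroup N] [Module k N] [Module A N] (m : M) (a : A)
    (n : N) : (Submodule.Quotient.mk (m ⊗ₜ (a • n)) : Balanced k N ρ) =
      Submodule.Quotient.mk (ρ (MulOpposite.op a) m ⊗ₜ n) := by
  have h : ρ (MulOpposite.op a) m ⊗ₜ n - m ⊗ₜ (a • n) ∈ balancedRelations k N ρ :=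
    Submodule.subset_span ⟨m, a, n, rfl⟩
  exact ((Submodule.Quotient.eq _).2 h).symm

section Balanced

variable {k : Type u} [Field k] {A C : Type u} [Ring A] [Algebra k A] [Ring C] [Algebra k C]
variable {M : Type u} [AddCommGroup M] [Module k M] [Module C M] [IsScalarTower k C M]

/-- For a `(C, A)`-bimodule `M`, the map `M ⊗_A A^r → M^r`, `m ⊗ a ↦ (m a_l)_l`. -/
def balancedPiHom (ρ : Aᵐᵒᵖ →+* Module.End C M)
    (hρ : ∀ (c : k) a m, ρ (MulOpposite.op (c • a)) m = c • ρ (MulOpposite.op a) m) (r : ℕ) :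
    Balanced k (Fin r → A) ρ →ₗ[C] (Fin r → M) :=
  Submodule.liftQ _ (AlgebraTensorModule.lift
    { toFun := fun m =>
        { toFun := fun n l => ρ (MulOpposite.op (n l)) m
          map_add' := fun n n' => by ext l; simp
          map_smul' := fun c n => by ext l; simpa using hρ c (n l) m }
      map_add' := fun m m' => by ext n l; simp
      map_smul' := fun c m => by ext n l; simp }) (by
    refine Submodule.span_le.2 ?_
    rintro _ ⟨m, a, n, rfl⟩
    change AlgebraTensorModule.lift _ _ = _
    rw [map_sub, sub_eq_zero]
    ext l
    simp)

variable (ρ : Aᵐᵒᵖ →+* Module.End C M)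
    (hρ : ∀ (c : k) a m, ρ (MulOpposite.op (c • a)) m = c • ρ (MulOpposite.op a) m)

theorem balancedPiHom_mk {r : ℕ} (m : M) (n : Fin r → A) (l : Fin r) :
    balancedPiHom ρ hρ r (Submodule.Quotient.mk (m ⊗ₜ n)) l = ρ (MulOpposite.op (n l)) m := rfl

variable (k) in
/-- The map `M^r → M ⊗_A A^r`, `x ↦ ∑ x_l ⊗ e_l`. -/
def balancedPiInv (r : ℕ) : (Fin r → M) →ₗ[C] Balanced k (Fin r → A) ρ :=
  ∑ l, (balancedRelations k (Fin r → A) ρ).mkQ ∘ₗ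
    (AlgebraTensorModule.mk k C M (Fin r → A)).flip (Pi.single l 1) ∘ₗ LinearMap.proj l

theorem balancedPiInv_apply {r : ℕ} (x : Fin r → M) : balancedPiInv k ρ r x =
    ∑ l, Submodule.Quotient.mk (x l ⊗ₜ[k] (Pi.single l 1 : Fin r → A)) := by
  simp [balancedPiInv]

/-- For a `(C, A)`-bimodule `M`, the isomorphism `M ⊗_A A^r ≃ M^r`. -/
def balancedPi (r : ℕ) : Balanced k (Fin r → A) ρ ≃ₗ[C] (Fin r → M) :=
  LinearEquiv.ofLinearMap (balancedPiHom ρ hρ r) (balancedPiInv k ρ r)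
    (by
      refine LinearMap.ext fun x => funext fun l => ?_
      rw [LinearMap.comp_apply, balancedPiInv_apply, map_sum, Finset.sum_apply,
        Finset.sum_eq_single l]
      · rw [balancedPiHom_mk, Pi.single_eq_same, MulOpposite.op_one, map_one]
        rfl
      · intro i _ hi
        rw [balancedPiHom_mk, Pi.single_eq_of_ne hi.symm, MulOpposite.op_zero, map_zero]
        rfl
      · simp)
    (by
      refine Balanced.ext fun m n => ?_
      rw [LinearMap.comp_apply, balancedPiInv_apply, LinearMap.id_apply]
      simp only [balancedPiHom_mk, ← balanced_mk_smul]
      rw [← Submodule.mkQ_apply]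
      simp only [← Submodule.mkQ_apply]
      rw [← map_sum, ← tmul_sum, ← pi_eq_sum_univ'])

theorem balancedPi_symm_apply {r : ℕ} (x : Fin r → M) : (balancedPi ρ hρ r).symm x =
    ∑ l, Submodule.Quotient.mk (x l ⊗ₜ[k] (Pi.single l 1 : Fin r → A)) :=
  balancedPiInv_apply ρ x

end Balanced

section Resolution

variable {k : Type u} [Field k] {A B : Type u} [Ring A] [Algebra k A] [Ring B] [Algebra k B]
variable {𝒜 : ℤ → Submodule k A} {ℬ : ℤ → Submodule k B}
variable [GradedAlgebra ℬ] [IsConnectedGraded ℬ]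
variable {τ : TwistingMap 𝒜 ℬ}

open TwistedTensor

/-! ## The resolution of `A` by the complex `A ⊗^τ Q` -/

/-- The augmentation of `B ⊗ W₀` as a `k`-linear map to `k`. -/
def augFree (Q : FreeComplex ℬ) : (Fin (Q.rank 0) → B) →ₗ[k] k :=
  ∑ i, (augmentation ℬ).toLinearMap ∘ₗ LinearMap.proj i

theorem augFree_apply (Q : FreeComplex ℬ) (x : Fin (Q.rank 0) → B) :
    augFree Q x = ∑ i, augmentation ℬ (x i) := by
  simp [augFree]

theorem exact_augFree {Q : FreeComplex ℬ} (hQ : Q.IsMinimalResolution) :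
    Function.Exact (Q.d 0) (augFree Q) := by
  intro x
  rw [augFree_apply]
  exact hQ.exact_aug x

section Projection

variable (τ) in
/-- The map `A ⊗^τ B ⊗ W₀ → A` induced by `ε_B`. -/
def projFree (Q : FreeComplex ℬ) : (Fin (Q.rank 0) → TwistedTensor τ) →ₗ[k] A :=
  ∑ i, projA τ ∘ₗ LinearMap.proj i

variable {Q : FreeComplex ℬ}

theorem projFree_apply (x : Fin (Q.rank 0) → TwistedTensor τ) :
    projFree τ Q x = ∑ i, projA τ (x i) := by
  simp [projFree]

theorem projFree_inducedEquiv (x : A ⊗[k] (Fin (Q.rank 0) → B)) :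
    projFree τ Q (inducedEquiv τ _ x) =
      TensorProduct.rid k A (LinearMap.lTensor A (augFree Q) x) := by
  induction x with
  | zero => simp
  | add x y hx hy => simp only [map_add, hx, hy]
  | tmul a q =>
    rw [projFree_apply]
    simp only [inducedEquiv_tmul, ← inclA_mul_inclB, projA_mul_inclB, ← Finset.sum_smul,
      ← augFree_apply]
    rfl

theorem projFree_surjective : Function.Surjective (projFree τ Q) := by
  intro a
  let i : Fin (Q.rank 0) := Fin.cast Q.rank_zero.symm 0
  refine ⟨Pi.single i (inclA τ a * inclB τ 1), ?_⟩
  rw [projFree_apply, Finset.sum_eq_single i]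
  · rw [Pi.single_eq_same, projA_mul_inclB, map_one, one_smul]
  · intro j _ hj
    rw [Pi.single_eq_of_ne hj, map_zero]
  · simp

/-- Tensor the end Q₁ → Q₀ → k of the resolution with the flat module A; together with
`exact_inducedMap` this makes A ⊗^τ Q a resolution of A. -/
theorem exact_projFree (hQ : Q.IsMinimalResolution) :
    Function.Exact (inducedMap τ (Q.d 0)) (projFree τ Q) := by
  intro x
  obtain ⟨x, rfl⟩ := (inducedEquiv τ _).surjective x
  have h' : Function.Exact (LinearMap.lTensor A ((Q.d 0).restrictScalars k))
      (LinearMap.lTensor A (augFree Q)) := Module.Flat.lTensor_exact A (exact_augFree hQ)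
  rw [projFree_inducedEquiv, LinearEquiv.map_eq_zero_iff, h' x]
  constructor
  · rintro ⟨y, rfl⟩
    exact ⟨inducedEquiv τ _ y, inducedMap_inducedEquiv τ _ y⟩
  · rintro ⟨y, hy⟩
    obtain ⟨y, rfl⟩ := (inducedEquiv τ _).surjective y
    rw [inducedMap_inducedEquiv] at hy
    exact ⟨y, (inducedEquiv τ _).injective hy⟩

end Projection

variable [GradedAlgebra 𝒜]

/-! ### The double complex F_φ ⊗_A P in coordinates -/

namespace BimoduleTwist

variable {Q : FreeComplex ℬ} {m : ℕ} {hm : Q.rank 1 = m} {σ : A →ₐ[k] Matrix (Fin m) (Fin m) A}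
variable (Φ : BimoduleTwist τ Q hm σ)

/-- Since φ₀ is the identity, the right action on F₀ is multiplication by a in each coordinate, and
`projA` respects that. -/
theorem projFree_twistedRight (hbi : τ.PreservesBidegree)
    (x : Fin (Q.rank 0) → TwistedTensor τ) (a : A) :
    projFree τ Q (twistedRight τ (Φ.φ 0) (MulOpposite.op a) x) = projFree τ Q x * a := by
  rw [projFree_apply, projFree_apply, Finset.sum_mul]
  refine Finset.sum_congr rfl fun i _ => ?_
  rw [← projA_mul_inclA hbi, twistedRight_apply, Φ.φ_zero]
  congr 1
  simp [Matrix.diagonal_apply, apply_ite]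

variable [IsConnectedGraded 𝒜] (P : FreeComplex 𝒜)

/-- The isomorphism `F_p ⊗_A P_q ≃ C ⊗ W_p ⊗ V_q`. -/
def pieceEquiv (p q : ℕ) :
    Φ.Piece P p q ≃ₗ[TwistedTensor τ] (Fin (P.rank q) → Fin (Q.rank p) → TwistedTensor τ) :=
  balancedPi _ (twistedRight_smul τ (Φ.φ p)) (P.rank q)

/-- Right A-linearity of d_F is what allows it to pass coordinatewise through F_p ⊗_A A^r ≃ F_p^r.
-/
theorem pieceEquiv_dLeft (p q : ℕ) (z : Φ.Piece P (p + 1) q) (l : Fin (P.rank q)) :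
    Φ.pieceEquiv P p q (Φ.dLeft P p q z) l =
      inducedMap τ (Q.d p) (Φ.pieceEquiv P (p + 1) q z l) := by
  refine LinearMap.congr_fun
    (f := LinearMap.proj l ∘ₗ (Φ.pieceEquiv P p q).toLinearMap ∘ₗ Φ.dLeft P p q)
    (g := inducedMap τ (Q.d p) ∘ₗ LinearMap.proj l ∘ₗ (Φ.pieceEquiv P (p + 1) q).toLinearMap)
    (Balanced.ext fun x y => ?_) z
  exact (Φ.d_right p _ _).symm

/-- Entries of d_P move across ⊗_A and become right multiplications on F_p, hence act through φ_p.
-/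
theorem pieceEquiv_dRight (p q : ℕ) (z : Φ.Piece P p (q + 1)) (l : Fin (P.rank q)) :
    Φ.pieceEquiv P p q (Φ.dRight P p q z) l = ∑ i, twistedRight τ (Φ.φ p)
      (MulOpposite.op (P.d q (Pi.single i 1) l)) (Φ.pieceEquiv P p (q + 1) z i) := by
  obtain ⟨z, rfl⟩ := (Φ.pieceEquiv P p (q + 1)).symm.surjective z
  have h : (Φ.pieceEquiv P p (q + 1)).symm z = _ := balancedPi_symm_apply _ _ z
  rw [LinearEquiv.apply_symm_apply, h, map_sum, map_sum, Finset.sum_apply]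
  rfl

/-- For fixed q the complex is a direct sum of copies of F, one for each basis vector of V_q, so
exactness and preimages are found coordinate by coordinate. -/
theorem exact_dLeft (hQ : Q.IsMinimalResolution) (p q : ℕ) :
    Function.Exact (Φ.dLeft P (p + 1) q) (Φ.dLeft P p q) := by
  have h := exact_inducedMap τ (hQ.exact_d p)
  intro z
  rw [← LinearEquiv.map_eq_zero_iff (Φ.pieceEquiv P p q)]
  constructor
  · intro hz
    choose u hu using fun l => (h (Φ.pieceEquiv P (p + 1) q z l)).1 (by
      rw [← pieceEquiv_dLeft, hz, Pi.zero_apply])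
    refine ⟨(Φ.pieceEquiv P (p + 2) q).symm u, (Φ.pieceEquiv P (p + 1) q).injective ?_⟩
    ext1 l
    rw [pieceEquiv_dLeft, LinearEquiv.apply_symm_apply, hu]
  · rintro ⟨u, rfl⟩
    ext1 l
    rw [pieceEquiv_dLeft, pieceEquiv_dLeft, h.apply_apply_eq_zero, Pi.zero_apply]

/-- The map `F_0 ⊗_A P_q → A ⊗_A P_q = P_q` induced by `id_A ⊗ ε_B`. -/
def project (q : ℕ) : Φ.Piece P 0 q →+ (Fin (P.rank q) → A) :=
  (((projFree τ Q).compLeft (Fin (P.rank q))).toAddMonoidHom).comp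
    (Φ.pieceEquiv P 0 q).toLinearMap.toAddMonoidHom

theorem project_apply (q : ℕ) (z : Φ.Piece P 0 q) (l : Fin (P.rank q)) :
    Φ.project P q z l = projFree τ Q (Φ.pieceEquiv P 0 q z l) := rfl

theorem project_surjective (q : ℕ) : Function.Surjective (Φ.project P q) := by
  intro v
  choose u hu using fun l => projFree_surjective (τ := τ) (Q := Q) (v l)
  refine ⟨(Φ.pieceEquiv P 0 q).symm u, funext fun l => ?_⟩
  rw [project_apply, LinearEquiv.apply_symm_apply, hu]

theorem exact_project (hQ : Q.IsMinimalResolution) (q : ℕ) :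
    Function.Exact (Φ.dLeft P 0 q) (Φ.project P q) := by
  have h := exact_projFree (τ := τ) hQ
  intro z
  constructor
  · intro hz
    choose u hu using fun l => (h (Φ.pieceEquiv P 0 q z l)).1 (by
      rw [← project_apply, hz, Pi.zero_apply])
    refine ⟨(Φ.pieceEquiv P 1 q).symm u, (Φ.pieceEquiv P 0 q).injective ?_⟩
    ext1 l
    rw [pieceEquiv_dLeft, LinearEquiv.apply_symm_apply, hu]
  · rintro ⟨u, rfl⟩
    ext1 l
    rw [project_apply, pieceEquiv_dLeft, h.apply_apply_eq_zero, Pi.zero_apply]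

/-- Right A-linearity of F₀ → A makes the projection a chain map F₀ ⊗_A P → P; the comparison of the
total complex with P goes through it. -/
theorem project_dRight (hbi : τ.PreservesBidegree) (q : ℕ) (z : Φ.Piece P 0 (q + 1)) :
    Φ.project P q (Φ.dRight P 0 q z) = P.d q (Φ.project P (q + 1) z) := by
  ext l
  rw [project_apply, pieceEquiv_dRight, linearMap_pi_apply, map_sum]
  exact Finset.sum_congr rfl fun i _ => Φ.projFree_twistedRight hbi _ _

/-- ε_C factors as ε_A after id_A ⊗ ε_B, so the augmentation of the total complex is that of P after
projection. -/
theorem aug₀₀_eq (hbi : τ.PreservesBidegree) (z : Φ.Piece P 0 0) :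
    Φ.aug₀₀ P z = (show k from ∑ l, augmentation 𝒜 (Φ.project P 0 z l)) := by
  obtain ⟨t, rfl⟩ := Submodule.Quotient.mk_surjective _ z
  induction t with
  | zero => simp; rfl
  | add t t' h h' =>
    rw [Submodule.Quotient.mk_add, map_add, map_add, h, h']
    simp only [Pi.add_apply, map_add, Finset.sum_add_distrib]
    rfl
  | tmul x y =>
    have h (l : Fin (P.rank 0)) : augmentation 𝒜 (Φ.project P 0 (Submodule.Quotient.mk (x ⊗ₜ y)) l) =
        inducedAug τ Q x * augmentation 𝒜 (y l) := by
      have h' : Φ.project P 0 (Submodule.Quotient.mk (x ⊗ₜ y)) l = projFree τ Q x * y l :=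
        Φ.projFree_twistedRight hbi x (y l)
      rw [h', map_mul, projFree_apply, map_sum]
      simp only [augmentation_projA, inducedAug]
    simp only [h, ← Finset.mul_sum]
    rfl

end BimoduleTwist
end Resolution

section Resolution

variable {k : Type u} [Field k] {A B : Type u} [Ring A] [Algebra k A] [Ring B] [Algebra k B]
variable {𝒜 : ℤ → Submodule k A} {ℬ : ℤ → Submodule k B}
variable [GradedAlgebra 𝒜] [IsConnectedGraded 𝒜] [GradedAlgebra ℬ] [IsConnectedGraded ℬ]
variable {τ : TwistingMap 𝒜 ℬ}

namespace BimoduleTwist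

variable {Q : FreeComplex ℬ} {m : ℕ} {hm : Q.rank 1 = m} {σ : A →ₐ[k] Matrix (Fin m) (Fin m) A}
variable (Φ : BimoduleTwist τ Q hm σ) (P : FreeComplex 𝒜)

/-! ## Exactness of the total complex -/

theorem d_apply (n : ℕ) (x : Φ.Term P (n + 1)) (p q : ℕ) (h : p + q = n) :
    Φ.d P n x ⟨(p, q), h⟩ = Φ.dLeft P p q (x ⟨(p + 1, q), by simp only; omega⟩) +
      (-1 : ℤ) ^ p • Φ.dRight P p q (x ⟨(p, q + 1), by simp only; omega⟩) := rfl

/-- The element of `⨁ F_p ⊗_A P_q` concentrated in one summand. -/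
def single {n : ℕ} (p q : ℕ) (h : p + q = n) (z : Φ.Piece P p q) : Φ.Term P n :=
  Pi.single (M := fun s : {s : ℕ × ℕ // s.1 + s.2 = n} => Φ.Piece P s.1.1 s.1.2) ⟨(p, q), h⟩ z

theorem single_same {n : ℕ} (p q : ℕ) (h : p + q = n) (z : Φ.Piece P p q) :
    Φ.single P p q h z ⟨(p, q), h⟩ = z :=
  Pi.single_eq_same (M := fun s : {s : ℕ × ℕ // s.1 + s.2 = n} => Φ.Piece P s.1.1 s.1.2) _ _

theorem single_of_ne {n : ℕ} (p q : ℕ) (h : p + q = n) (z : Φ.Piece P p q)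
    (s : {s : ℕ × ℕ // s.1 + s.2 = n}) (hs : s.1.1 ≠ p) : Φ.single P p q h z s = 0 :=
  Pi.single_eq_of_ne (M := fun s : {s : ℕ × ℕ // s.1 + s.2 = n} => Φ.Piece P s.1.1 s.1.2)
    (by rintro rfl; exact hs rfl) _

variable {P}

/-- A cycle whose components in `F_p ⊗_A P` vanish for `p < N` is a boundary. -/
theorem exists_d_eq_of_vanish (hQ : Q.IsMinimalResolution) {n : ℕ} (N : ℕ) (hN : 1 ≤ N)
    (x : Φ.Term P (n + 1)) (hx : Φ.d P n x = 0) (h : ∀ s, s.1.1 < N → x s = 0) :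
    ∃ z, Φ.d P (n + 1) z = x := by
  -- In total degree n + 1 the index p is at most n + 1, so for N ≥ n + 2 every component of x
  -- vanishes.
  induction j : n + 2 - N generalizing N x with
  | zero =>
    refine ⟨0, ?_⟩
    ext1 s
    rw [map_zero, Pi.zero_apply, h s (by have := s.2; omega)]
  | succ j ih =>
    obtain ⟨M, rfl⟩ : ∃ M, N = M + 1 := ⟨N - 1, by omega⟩
    obtain ⟨q, hq⟩ : ∃ q, M + q = n := ⟨n - M, by omega⟩
    -- In the (M, q) component of d x = 0 the contribution of x_{M, q+1} vanishes by hypothesis, so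
    -- the first nonzero component of x is a cycle for d_F and lifts along d_F.
    have h0 : Φ.dLeft P M q (x ⟨(M + 1, q), by simp only; omega⟩) = 0 := by
      have := congrFun hx ⟨(M, q), hq⟩
      rwa [d_apply, h ⟨(M, q + 1), _⟩ (by simp), map_zero, smul_zero, add_zero] at this
    obtain ⟨u, hu⟩ := (Φ.exact_dLeft P hQ M q _).1 h0
    let w := Φ.single P (n := n + 2) (M + 2) q (by omega) u
    have hw : w ⟨(M + 2, q), by simp only; omega⟩ = u := Φ.single_same P _ _ _ u
    have hw' (s) (hs : s.1.1 ≠ M + 2) : w s = 0 := Φ.single_of_ne P _ _ _ u s hs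
    -- With w placed at p = M + 2, d w meets only p = M + 1 and p = M + 2. Subtracting it clears the
    -- component at M + 1 and disturbs none below.
    obtain ⟨z, hz⟩ := ih (M + 2) (by omega) (x - Φ.d P (n + 1) w)
      (by
        rw [map_sub, hx, ← LinearMap.comp_apply, Φ.d_comp_d, LinearMap.zero_apply, sub_zero])
      (by
        rintro ⟨⟨p, r⟩, hs⟩ hp
        simp only at hs hp
        rw [Pi.sub_apply, d_apply, hw' ⟨(p, r + 1), _⟩ (by simp only; omega),
          map_zero, smul_zero, add_zero]
        by_cases hpM : p = M + 1
        · subst hpM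
          obtain rfl : r = q := by omega
          rw [hw, hu, sub_self]
        · rw [hw' ⟨(p + 1, r), _⟩ (by simp only; omega), map_zero, sub_zero,
            h _ (by simp only; omega)])
      (by omega)
    exact ⟨z + w, by rw [map_add, hz, sub_add_cancel]⟩

/-- If the projection of `x₀ ∈ F₀ ⊗_A P_q` to `P_q` is a boundary, then `x₀` is a boundary up to
terms in `F_p ⊗_A P` with `p ≥ 1`. -/
theorem exists_dLeft_add_dRight (hQ : Q.IsMinimalResolution) (hbi : τ.PreservesBidegree) {q : ℕ}
    (x : Φ.Piece P 0 q) (v : Fin (P.rank (q + 1)) → A) (hv : P.d q v = Φ.project P q x) :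
    ∃ u w, Φ.dLeft P 0 q u + Φ.dRight P 0 q w = x := by
  -- Lift v to F₀ ⊗_A P_{q+1}; then x - (id ⊗ d_P) w projects to zero and so lies in the image of
  -- d_F.
  obtain ⟨w, rfl⟩ := Φ.project_surjective P (q + 1) v
  rw [← Φ.project_dRight P hbi] at hv
  obtain ⟨u, hu⟩ := (Φ.exact_project P hQ q (x - Φ.dRight P 0 q w)).1 (by
    rw [map_sub, hv, sub_self])
  exact ⟨u, w, by rw [hu, sub_add_cancel]⟩

theorem d_single_add_single {q : ℕ} (u : Φ.Piece P 1 q) (w : Φ.Piece P 0 (q + 1)) :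
    Φ.d P q (Φ.single P 1 q (add_comm 1 q) u + Φ.single P 0 (q + 1) (zero_add _) w)
      ⟨(0, q), zero_add q⟩ = Φ.dLeft P 0 q u + Φ.dRight P 0 q w := by
  rw [d_apply, Pi.add_apply, Pi.add_apply, Φ.single_same, Φ.single_same,
    Φ.single_of_ne P 0 (q + 1) _ _ ⟨(0 + 1, q), _⟩ (by simp),
    Φ.single_of_ne P 1 q _ _ ⟨(0, q + 1), _⟩ (by simp), add_zero, zero_add w, pow_zero,
    one_smul]

/-- The p = 0 component of a cycle projects to a cycle of P, hence to a boundary. Correcting by a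
boundary of the total complex removes that component, and the remainder is handled by the chase with
N = 1. -/
theorem exact_d (hP : P.IsMinimalResolution) (hQ : Q.IsMinimalResolution)
    (hbi : τ.PreservesBidegree) (n : ℕ) : Function.Exact (Φ.d P (n + 1)) (Φ.d P n) := by
  intro x
  constructor
  · intro hx
    have h0 : P.d n (Φ.project P (n + 1) (x ⟨(0, n + 1), zero_add _⟩)) = 0 := by
      have h := congrArg (Φ.project P n) (congrFun hx ⟨(0, n), zero_add n⟩)
      rwa [d_apply, map_add, (Φ.exact_project P hQ n).apply_apply_eq_zero, pow_zero, one_smul,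
        Φ.project_dRight P hbi, Pi.zero_apply, map_zero, zero_add] at h
    obtain ⟨v, hv⟩ := (hP.exact_d n _).1 h0
    obtain ⟨u, w, huw⟩ := Φ.exists_dLeft_add_dRight hQ hbi _ v hv
    let t : Φ.Term P (n + 2) :=
      Φ.single P 1 (n + 1) (add_comm 1 (n + 1)) u + Φ.single P 0 (n + 2) (zero_add _) w
    obtain ⟨z, hz⟩ := Φ.exists_d_eq_of_vanish hQ 1 le_rfl (x - Φ.d P (n + 1) t)
      (by rw [map_sub, hx, ← LinearMap.comp_apply, Φ.d_comp_d, LinearMap.zero_apply, sub_zero])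
      (by
        rintro ⟨⟨p, q⟩, hs⟩ hp
        simp only at hs hp
        obtain rfl : p = 0 := by omega
        obtain rfl : q = n + 1 := by omega
        rw [Pi.sub_apply, Φ.d_single_add_single, huw, sub_self])
    exact ⟨z + t, by rw [map_add, hz, sub_add_cancel]⟩
  · rintro ⟨z, rfl⟩
    rw [← LinearMap.comp_apply, Φ.d_comp_d, LinearMap.zero_apply]

theorem aug₀_eq (hbi : τ.PreservesBidegree) (x : Φ.Term P 0) :
    Φ.aug₀ P x = P.aug₀ (Φ.project P 0 (x ⟨(0, 0), rfl⟩)) :=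
  Φ.aug₀₀_eq P hbi _

/-- The same correction as in `exact_d`; in total degree zero the only summand has p = 0, so nothing
remains to be chased. -/
theorem exact_aug₀ (hP : P.IsMinimalResolution) (hQ : Q.IsMinimalResolution)
    (hbi : τ.PreservesBidegree) : Function.Exact (Φ.d P 0) (Φ.aug₀ P) := by
  intro x
  constructor
  · intro hx
    rw [Φ.aug₀_eq hbi] at hx
    obtain ⟨v, hv⟩ := (hP.exact_aug _).1 hx
    obtain ⟨u, w, huw⟩ := Φ.exists_dLeft_add_dRight hQ hbi _ v hv
    refine ⟨Φ.single P 1 0 (add_comm 1 0) u + Φ.single P 0 1 (zero_add _) w, ?_⟩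
    ext1 ⟨⟨p, q⟩, hs⟩
    simp only at hs
    obtain rfl : p = 0 := by omega
    obtain rfl : q = 0 := by omega
    exact (Φ.d_single_add_single u w).trans huw
  · rintro ⟨z, rfl⟩
    exact Φ.aug₀_d P z

theorem aug₀_surjective (hbi : τ.PreservesBidegree) : Function.Surjective (Φ.aug₀ P) := by
  intro c
  let i : Fin (P.rank 0) := Fin.cast P.rank_zero.symm 0
  obtain ⟨z, hz⟩ := Φ.project_surjective P 0 (Pi.single i (algebraMap k A c))
  refine ⟨Φ.single P 0 0 rfl z, ?_⟩
  rw [Φ.aug₀_eq hbi, Φ.single_same, hz]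
  change ∑ j, augmentation 𝒜 ((Pi.single i (algebraMap k A c) : Fin (P.rank 0) → A) j) = c
  rw [Finset.sum_eq_single i]
  · rw [Pi.single_eq_same]
    exact augmentation_algebraMap 𝒜 _
  · intro j _ hj
    rw [Pi.single_eq_of_ne hj, map_zero]
  · simp

theorem complex_d (n : ℕ) : (Φ.complex P).d (n + 1) n = ModuleCat.ofHom (Φ.d P n) :=
  ChainComplex.of_d (fun n => ModuleCat.of (TwistedTensor τ) (Φ.Term P n))
    (fun n => ModuleCat.ofHom (Φ.d P n)) n

theorem quasiIso_aug (hP : P.IsMinimalResolution) (hQ : Q.IsMinimalResolution)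
    (hbi : τ.PreservesBidegree) : QuasiIso (Φ.aug P) := by
  refine (quasiIso_single₀_iff _).2 ⟨fun n => ?_, ?_, Φ.aug₀_surjective hbi⟩
  · rw [complex_d, complex_d]
    exact Φ.exact_d hP hQ hbi n
  · rw [complex_d]
    exact Φ.exact_aug₀ hP hQ hbi

end BimoduleTwist
end Resolution

/-! ### Degree-preserving maps and the augmentation ideal -/

section Augmentation

variable {k : Type u} [Field k] {A : Type u} [Ring A] [Algebra k A]
variable {𝒜 : ℤ → Submodule k A} [GradedAlgebra 𝒜] [IsConnectedGraded 𝒜]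

/-- An element of augmentation zero has no degree zero component, and a degree-preserving map
creates none. -/
theorem augmentation_map_eq_zero {f : A →ₗ[k] A} (hf : ∀ n, ∀ a ∈ 𝒜 n, f a ∈ 𝒜 n) {a : A}
    (ha : augmentation 𝒜 a = 0) : augmentation 𝒜 (f a) = 0 := by
  classical
  rw [← DirectSum.sum_support_decompose 𝒜 a, map_sum, map_sum]
  refine Finset.sum_eq_zero fun n _ => ?_
  by_cases hn : n = 0
  · subst hn
    rw [decompose_zero_eq, ha, map_zero, map_zero, map_zero]
  · exact augmentation_of_ne 𝒜 hn (hf n _ (SetLike.coe_mem _))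

end Augmentation

section Resolution

variable {k : Type u} [Field k] {A B : Type u} [Ring A] [Algebra k A] [Ring B] [Algebra k B]
variable {𝒜 : ℤ → Submodule k A} {ℬ : ℤ → Submodule k B}
variable [GradedAlgebra 𝒜] [IsConnectedGraded 𝒜] [GradedAlgebra ℬ] [IsConnectedGraded ℬ]
variable {τ : TwistingMap 𝒜 ℬ}

open TwistedTensor

namespace BimoduleTwist

variable {Q : FreeComplex ℬ} {m : ℕ} {hm : Q.rank 1 = m} {σ : A →ₐ[k] Matrix (Fin m) (Fin m) A}
variable (Φ : BimoduleTwist τ Q hm σ) (P : FreeComplex 𝒜)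

/-! ## Gradings and minimality of the total complex -/

/-- The index set of the basis of `⨁_{p + q = n} F_p ⊗_A P_q`. -/
abbrev BasisIndex (_Φ : BimoduleTwist τ Q hm σ) (P : FreeComplex 𝒜) (n : ℕ) : Type u :=
  ULift.{u} (Σ s : {s : ℕ × ℕ // s.1 + s.2 = n}, Fin (P.rank s.1.2) × Fin (Q.rank s.1.1))

instance finite_basisIndex (n : ℕ) : Finite (Φ.BasisIndex P n) := by
  have : Finite {s : ℕ × ℕ // s.1 + s.2 = n} :=
    Set.Finite.subset (Finset.HasAntidiagonal.antidiagonal n).finite_toSet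
      fun s hs => Finset.mem_coe.2 (Finset.HasAntidiagonal.mem_antidiagonal.2 hs)
  infer_instance

/-- The term of degree `n` of `F_φ ⊗_A P` as a free module. -/
def termEquiv (n : ℕ) : Φ.Term P n ≃ₗ[TwistedTensor τ] (Φ.BasisIndex P n →₀ TwistedTensor τ) :=
  { toFun := fun x i => Φ.pieceEquiv P _ _ (x i.down.1) i.down.2.1 i.down.2.2
    invFun := fun c s => (Φ.pieceEquiv P _ _).symm fun l j => c ⟨s, l, j⟩
    map_add' := fun x y => by ext i; simp
    map_smul' := fun c x => by ext i; simp
    left_inv := fun x => by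
      ext1 s
      exact (Φ.pieceEquiv P _ _).symm_apply_apply (x s)
    right_inv := fun c => by
      ext ⟨s, l, j⟩
      exact congrFun (congrFun ((Φ.pieceEquiv P _ _).apply_symm_apply _) l) j :
    Φ.Term P n ≃ₗ[TwistedTensor τ] (Φ.BasisIndex P n → TwistedTensor τ) } ≪≫ₗ
  (Finsupp.linearEquivFunOnFinite _ _ _).symm

/-- Expand x in the C-basis of the term: each coefficient has augmentation zero and hence lies in
C_{≥1}. -/
theorem mem_positivePart_of_aug (n : ℕ) {x : Φ.Term P n}
    (hx : ∀ s l j, TwistedTensor.aug τ (Φ.pieceEquiv P s.1.1 s.1.2 (x s) l j) = 0) :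
    x ∈ positivePart (TwistedTensor.grading τ) (Φ.Term P n) := by
  rw [← (Φ.termEquiv P n).symm_apply_apply x, ← Finsupp.sum_single (Φ.termEquiv P n x),
    Finsupp.sum, map_sum]
  refine Submodule.sum_mem _ fun i _ => ?_
  rw [← mul_one (Φ.termEquiv P n x i), ← smul_eq_mul, ← Finsupp.smul_single, map_smul]
  exact smul_mem_positivePart (hx _ _ _) _

variable {P}

theorem aug_dLeft (hQ : Q.IsMinimalResolution) (p q : ℕ) (z : Φ.Piece P (p + 1) q)
    (l : Fin (P.rank q)) (j : Fin (Q.rank p)) :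
    TwistedTensor.aug τ (Φ.pieceEquiv P p q (Φ.dLeft P p q z) l j) = 0 := by
  rw [pieceEquiv_dLeft, inducedMap_apply, map_sum]
  refine Finset.sum_eq_zero fun i _ => ?_
  rw [map_mul, aug_inclB, hQ.augmentation_d, mul_zero]

/-- The entries of d_P have augmentation zero by minimality, and φ_p, being degree-preserving in
each matrix entry, keeps them so. -/
theorem aug_dRight (hP : P.IsMinimalResolution) (p q : ℕ) (z : Φ.Piece P p (q + 1))
    (l : Fin (P.rank q)) (j : Fin (Q.rank p)) :
    TwistedTensor.aug τ (Φ.pieceEquiv P p q (Φ.dRight P p q z) l j) = 0 := by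
  rw [pieceEquiv_dRight, Finset.sum_apply, map_sum]
  refine Finset.sum_eq_zero fun i _ => ?_
  rw [twistedRight_apply, map_sum]
  refine Finset.sum_eq_zero fun t _ => ?_
  have h : augmentation 𝒜 (Φ.φ p (P.d q (Pi.single i 1) l) t j) = 0 :=
    augmentation_map_eq_zero (f := (Matrix.entryLinearMap k A t j) ∘ₗ (Φ.φ p).toLinearMap)
      (fun n a ha => Φ.φ_graded p n a ha t j) (hP.augmentation_d q _ l)
  rw [map_mul, aug_inclA, h, mul_zero]

theorem range_d_le (hP : P.IsMinimalResolution) (hQ : Q.IsMinimalResolution) (n : ℕ) :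
    LinearMap.range (Φ.d P n) ≤ positivePart (TwistedTensor.grading τ) (Φ.Term P n) := by
  rintro _ ⟨x, rfl⟩
  refine Φ.mem_positivePart_of_aug P n fun s l j => ?_
  obtain ⟨⟨p, q⟩, h⟩ := s
  rw [d_apply, map_add, map_zsmul]
  simp only [Pi.add_apply, Pi.smul_apply, map_add, map_zsmul]
  rw [Φ.aug_dLeft hQ, Φ.aug_dRight hP, smul_zero, add_zero]

/-- Identifies the induced grading on F_p ⊗_A P_q with the one given by the basis of W_p ⊗ V_q, from
which graded freeness follows. -/
theorem mem_balancedGrading_iff (hpure : Q.IsPure) (hbi : τ.PreservesBidegree) (p q : ℕ) (n : ℤ)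
    (z : Φ.Piece P p q) :
    z ∈ balancedGrading (twistedRight τ (Φ.φ p)) (freeGrading (TwistedTensor.grading τ) (Q.deg p))
      (freeGrading 𝒜 (P.deg q)) n ↔
    ∀ l j, Φ.pieceEquiv P p q z l j ∈ TwistedTensor.grading τ (n - (P.deg q l + Q.deg p j)) := by
  constructor
  · obtain ⟨e, he⟩ := hpure p
    rintro ⟨t, ht, rfl⟩ l j
    change t ∈ tensorGrading _ _ n at ht
    refine (iSup_le fun s => Submodule.map₂_le.2 fun x hx y hy => ?_ :
      tensorGrading _ _ n ≤ (TwistedTensor.grading τ (n - (P.deg q l + Q.deg p j))).comap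
        ((LinearMap.proj j ∘ₗ LinearMap.proj l ∘ₗ (Φ.pieceEquiv P p q).toLinearMap ∘ₗ
          (balancedRelations k _ _).mkQ).restrictScalars k)) ht
    change twistedRight τ (Φ.φ p) (MulOpposite.op (y l)) x j ∈
      TwistedTensor.grading τ (n - (P.deg q l + Q.deg p j))
    rw [twistedRight_apply]
    refine Submodule.sum_mem _ fun i _ => ?_
    -- The i-th coordinate of x contributes to the j-th coordinate through φ_p; the degrees match
    -- because W_p is concentrated in one degree.
    refine mul_mem_grading hbi ?_ (hx i trivial)
      (inclA_mem_grading (Φ.φ_graded p _ _ (hy l trivial) i j))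
    rw [he, he]
    ring
  · intro h
    -- Conversely z = ∑ z_l ⊗ e_l with e_l of degree `P.deg q l`, which leaves degree n - `P.deg q
    -- l` for z_l.
    rw [← (Φ.pieceEquiv P p q).symm_apply_apply z]
    have hs : (Φ.pieceEquiv P p q).symm (Φ.pieceEquiv P p q z) = _ := balancedPi_symm_apply _ _ _
    rw [hs]
    refine Submodule.sum_mem _ fun l _ => ⟨_, ?_, rfl⟩
    refine Submodule.mem_iSup_of_mem (n - P.deg q l) (Submodule.apply_mem_map₂ _ ?_ ?_)
    · intro j _
      have := h l j
      rwa [← sub_sub] at this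
    · rw [sub_sub_cancel]
      exact single_mem_freeGrading _ l

theorem mem_grading_iff (hpure : Q.IsPure) (hbi : τ.PreservesBidegree) (n : ℕ) (j : ℤ)
    (x : Φ.Term P n) : x ∈ Φ.grading P n j ↔ ∀ s l i, Φ.pieceEquiv P s.1.1 s.1.2 (x s) l i ∈
      TwistedTensor.grading τ (j - (P.deg s.1.2 l + Q.deg s.1.1 i)) :=
  ⟨fun h s => (Φ.mem_balancedGrading_iff hpure hbi _ _ _ _).1 (h s trivial),
    fun h s _ => (Φ.mem_balancedGrading_iff hpure hbi _ _ _ _).2 (h s)⟩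

theorem isGradedFree (hpure : Q.IsPure) (hbi : τ.PreservesBidegree) (n : ℕ) :
    IsGradedFree (TwistedTensor.grading τ) (Φ.grading P n) := by
  refine ⟨Φ.BasisIndex P n,
    fun i => P.deg i.down.1.1.2 i.down.2.1 + Q.deg i.down.1.1.1 i.down.2.2,
    Φ.termEquiv P n, fun j x => ?_⟩
  refine (Φ.mem_grading_iff hpure hbi n j x).trans ?_
  exact ⟨fun h i => h _ _ _, fun h s l i => h ⟨s, l, i⟩⟩

theorem d_mem_grading (hP : P.IsMinimalResolution) (hQ : Q.IsMinimalResolution)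
    (hpure : Q.IsPure) (hbi : τ.PreservesBidegree) (n : ℕ) (j : ℤ) (x : Φ.Term P (n + 1))
    (hx : x ∈ Φ.grading P (n + 1) j) : Φ.d P n x ∈ Φ.grading P n j := by
  rw [mem_grading_iff Φ hpure hbi] at hx
  refine (Φ.mem_grading_iff hpure hbi n j _).2 ?_
  rintro ⟨⟨p, q⟩, hs⟩ l i
  rw [d_apply, map_add, map_zsmul]
  refine Submodule.add_mem _ ?_ (zsmul_mem (x := Φ.pieceEquiv P p q _ l i) ?_ _)
  · rw [pieceEquiv_dLeft, inducedMap_apply]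
    refine Submodule.sum_mem _ fun t _ => ?_
    refine mul_mem_grading hbi ?_ (hx ⟨(p + 1, q), _⟩ l t) (inclB_mem_grading (hQ.d_single_mem p t i))
    simp only
    ring
  -- Again φ_p sends coordinate v to coordinate i of the same W_p, so purity makes the degree count
  -- independent of v and i.
  · obtain ⟨e, he⟩ := hpure p
    rw [pieceEquiv_dRight, Finset.sum_apply]
    refine Submodule.sum_mem _ fun t _ => ?_
    rw [twistedRight_apply]
    refine Submodule.sum_mem _ fun v _ => ?_
    refine mul_mem_grading hbi ?_ (hx ⟨(p, q + 1), _⟩ t v)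
      (inclA_mem_grading (Φ.φ_graded p _ _ (hP.d_single_mem q t l) v i))
    simp only [he]
    ring

theorem aug₀_eq_zero (hpure : Q.IsPure) (hbi : τ.PreservesBidegree) {j : ℤ} (hj : j ≠ 0)
    (x : Φ.Term P 0) (hx : x ∈ Φ.grading P 0 j) : Φ.aug₀ P x = 0 := by
  rw [mem_grading_iff Φ hpure hbi] at hx
  rw [Φ.aug₀_eq hbi]
  change ∑ l, augmentation 𝒜 (Φ.project P 0 (x ⟨(0, 0), rfl⟩) l) = 0
  refine Finset.sum_eq_zero fun l _ => ?_
  rw [project_apply, projFree_apply, map_sum]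
  refine Finset.sum_eq_zero fun i _ => ?_
  rw [augmentation_projA]
  refine aug_of_ne ?_ (hx ⟨(0, 0), rfl⟩ l i)
  rw [P.deg_zero, Q.deg_zero]
  simpa using hj

theorem isMinimalFreeResolution (hP : P.IsMinimalResolution) (hQ : Q.IsMinimalResolution)
    (hpure : Q.IsPure) (hbi : τ.PreservesBidegree) :
    IsMinimalFreeResolution (TwistedTensor.grading τ) (TwistedTensor.aug τ)
      (Φ.complex P) (Φ.grading P) (Φ.aug P) where
  free := Φ.isGradedFree hpure hbi
  d_graded n j x hx := by
    rw [complex_d]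
    exact Φ.d_mem_grading hP hQ hpure hbi n j x hx
  aug_graded j hj x hx := Φ.aug₀_eq_zero hpure hbi hj x hx
  quasiIso := Φ.quasiIso_aug hP hQ hbi
  minimal n := by
    rw [complex_d]
    exact Φ.range_d_le hP hQ n

end BimoduleTwist
end Resolution

end TwistedResolution

theorem mainTheorem4 {k : Type u} [Field k] {A B : Type u}
    [Ring A] [Algebra k A] [Ring B] [Algebra k B]
    (𝒜 : ℤ → Submodule k A) [GradedAlgebra 𝒜] [IsConnectedGraded 𝒜]
    (ℬ : ℤ → Submodule k B) [GradedAlgebra ℬ] [IsConnectedGraded ℬ]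
    (P : FreeComplex 𝒜) (hP : P.IsMinimalResolution)
    (Q : FreeComplex ℬ) (hQ : Q.IsMinimalResolution) (hpure : Q.IsPure)
    {m : ℕ} (y : Fin m → B) (hy : IsMinimalGeneratingSet ℬ y) (hm : Q.rank 1 = m)
    (hQy : ∀ j i, Q.d 0 (Pi.single j 1) i = y (Fin.cast hm j))
    (τ : TwistingMap 𝒜 ℬ) (σ : A →ₐ[k] Matrix (Fin m) (Fin m) A)
    (hσ : ∀ d, ∀ a ∈ 𝒜 d, ∀ i j, σ a i j ∈ 𝒜 d)
    (hτ : ∀ i a, τ.toLin (y i ⊗ₜ[k] a) = ∑ t, σ a i t ⊗ₜ[k] y t) :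
    Nonempty (BimoduleTwist τ Q hm σ) ∧
      ∀ Φ : BimoduleTwist τ Q hm σ,
        QuasiIso (Φ.aug P) ∧
        IsMinimalFreeResolution (TwistedTensor.grading τ) (TwistedTensor.aug τ)
          (Φ.complex P) (Φ.grading P) (Φ.aug P) := by
  have hbi := preservesBidegree_of_resolution hQ hpure hy hm hQy hσ hτ
  exact ⟨nonempty_bimoduleTwist hQ hpure hm hQy hbi σ hσ hτ, fun Φ =>
    ⟨Φ.quasiIso_aug hP hQ hbi, Φ.isMinimalFreeResolution hP hQ hpure hbi⟩⟩
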